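/- Let $\Lambda$ be an Artin algebra, that is, an algebra over a commutative artinian ring $R$ that is finitely generated as an $R$-module. Modules are finitely generated right $\Lambda$-modules unless stated otherwise. A module is Gorenstein projective if it is isomorphic to a syzygy of a complex $P^\bullet$ of finitely generated projective modules such that both $P^\bullet$ and $\mathrm{Hom}_\Lambda(P^\bullet,\Lambda)$ are acyclic; $\mathrm{Gprj}\text{-}\Lambda$ denotes the full subcategory of these modules, and $\underline{\mathrm{Gprj}}\text{-}\Lambda$ its stable category, i.e. its quotient by the morphisms that factor through a finitely generated projective module. Call $\Lambda$ an $\Omega_{\mathcal G}$-algebra if the category $\mathrm{mod}\text{-}(\underline{\mathrm{Gprj}}\text{-}\Lambda)$ of finitely presented contravariant additive functors from $\underline{\mathrm{Gprj}}\text{-}\Lambda$ to abelian groups is a semisimple abelian category, i.e. an abelian category all of whose objects are projective. Call $\Lambda$ $1$-Gorenstein if the injective dimension of $\Lambda$, both as a left and as a right $\Lambda$-module, is at most $1$. For a module $M$, let $\mathrm{add}(M)$ be the class of modules isomorphic to a direct summand of a finite direct sum of copies of $M$, and let $\mathrm{rad}\,\Lambda$ be the Jacobson radical of $\Lambda$,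 regarded as a right module. Then the following conditions are equivalent: (i) $\Lambda$ is a $1$-Gorenstein $\Omega_{\mathcal G}$-algebra; (ii) $\mathrm{Gprj}\text{-}\Lambda=\mathrm{add}(\mathrm{rad}\,\Lambda\oplus\Lambda)$. -/

import Mathlib

open CategoryTheory

namespace GProj

universe w v u

/-! Modules are left modules over a ring `A`; right `Λ`-modules are obtained by taking
`A = Λᵐᵒᵖ`. The regular left `A`-module is then the regular right `Λ`-module. -/

/-- A totally acyclic complex of finitely generated projective `A`-modules: an acyclic complex
`P` of such modules, indexed by `ℤ`, for which the complex `Hom_A(P, A)` is acyclic too. -/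
structure TotallyAcyclicComplex (A : Type u) [Ring A] where
  /-- The terms of the complex. -/
  X : ℤ → ModuleCat.{u} A
  /-- The differentials of the complex. -/
  d : ∀ i : ℤ, X i →ₗ[A] X (i + 1)
  finite : ∀ i, Module.Finite A (X i)
  projective : ∀ i, Module.Projective A (X i)
  exact : ∀ i, Function.Exact (d i) (d (i + 1))
  hom_exact : ∀ i, Function.Exact
    (fun φ : X (i + 1 + 1) →ₗ[A] A => φ ∘ₗ d (i + 1))
    (fun φ : X (i + 1) →ₗ[A] A => φ ∘ₗ d i)

/-- The finitely generated Gorenstein projective `A`-modules: those isomorphic to a syzygy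
(the kernel of a differential) of a totally acyclic complex. -/
def gprj (A : Type u) [Ring A] : ObjectProperty (ModuleCat.{u} A) := fun G =>
  Module.Finite A G ∧ ∃ (P : TotallyAcyclicComplex A) (i : ℤ),
    Nonempty (G ≃ₗ[A] LinearMap.ker (P.d i))

/-- `add M`: the modules isomorphic to a direct summand of a finite direct sum of copies
of `M`. -/
def addClosure {A : Type u} [Ring A] (M : ModuleCat.{u} A) : ObjectProperty (ModuleCat.{u} A) :=
  fun X => ∃ (n : ℕ) (N : Submodule A (Fin n → M)), IsComplemented N ∧ Nonempty (X ≃ₗ[A] N)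

/-- Two morphisms between Gorenstein projective modules are identified when their difference
factors through a finitely generated projective module. -/
def stableRel (A : Type u) [Ring A] : HomRel (gprj A).FullSubcategory := fun X Y f g =>
  ∃ (P : ModuleCat.{u} A) (a : X.obj ⟶ P) (b : P ⟶ Y.obj),
    Module.Finite A P ∧ Module.Projective A P ∧ (f - g).hom = a ≫ b

theorem stableRel_add {A : Type u} [Ring A] ⦃X Y : (gprj A).FullSubcategory⦄
    (f₁ f₂ g₁ g₂ : X ⟶ Y) (hf : stableRel A f₁ f₂) (hg : stableRel A g₁ g₂) :
    stableRel A (f₁ + g₁) (f₂ + g₂) := by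
  obtain ⟨P, a, b, hP, hP', h⟩ := hf
  obtain ⟨Q, c, e, hQ, hQ', k⟩ := hg
  refine ⟨ModuleCat.of A (P × Q), ModuleCat.ofHom (a.hom.prod c.hom),
    ModuleCat.ofHom (b.hom.coprod e.hom), inferInstanceAs (Module.Finite A (P × Q)),
    inferInstanceAs (Module.Projective A (P × Q)), ?_⟩
  have : (f₁ + g₁) - (f₂ + g₂) = (f₁ - f₂) + (g₁ - g₂) := by abel
  rw [this]
  change (f₁ - f₂).hom + (g₁ - g₂).hom = _
  rw [h, k]
  ext x
  simp

instance stableRel_congruence (A : Type u) [Ring A] : Congruence (stableRel A) where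
  comp_left := by
    rintro X Y Z f g g' ⟨P, a, b, hP, hP', h⟩
    refine ⟨P, f.hom ≫ a, b, hP, hP', ?_⟩
    rw [← Preadditive.comp_sub, Category.assoc, ← h]
    rfl
  comp_right := by
    rintro X Y Z f f' g ⟨P, a, b, hP, hP', h⟩
    refine ⟨P, a, b ≫ g.hom, hP, hP', ?_⟩
    rw [← Preadditive.sub_comp, ← Category.assoc, ← h]
    rfl
  equivalence := by
    intro X Y
    refine ⟨fun f => ?_, ?_, ?_⟩
    · refine ⟨ModuleCat.of A PUnit.{u + 1}, 0, 0, inferInstanceAs (Module.Finite A PUnit.{u + 1}),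
        inferInstanceAs (Module.Projective A PUnit.{u + 1}), ?_⟩
      rw [sub_self, Limits.comp_zero]
      rfl
    · rintro f g ⟨P, a, b, hP, hP', h⟩
      refine ⟨P, a, -b, hP, hP', ?_⟩
      rw [Preadditive.comp_neg, ← h, ← neg_sub f g]
      rfl
    · intro f g k h₁ h₂
      have h := stableRel_add _ _ _ _ h₁ h₂
      obtain ⟨P, a, b, hP, hP', h⟩ := h
      refine ⟨P, a, b, hP, hP', ?_⟩
      rw [← h]
      congr 1
      abel

/-- The stable category of finitely generated Gorenstein projective `A`-modules. -/
abbrev StableGprj (A : Type u) [Ring A] : Type (u + 1) := Quotient (stableRel A)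

/-- The additive structure on the stable category: sums of residue classes. -/
instance stableGprjPreadditive (A : Type u) [Ring A] : Preadditive (StableGprj A) :=
  Quotient.preadditive (stableRel A) stableRel_add

section Functors

variable (C : Type w) [Category.{v} C] [Preadditive C]

/-- The finitely presented `C`-modules: contravariant additive functors `F` from `C` to abelian
groups that admit an exact sequence `C(-, X) ⟶ C(-, X') ⟶ F ⟶ 0` with `X`, `X'` in `C`. -/
def finPresFunctor : ObjectProperty (Cᵒᵖ ⥤ AddCommGrpCat.{v}) := fun F =>
  F.Additive ∧ ∃ (X X' : C) (f : X ⟶ X') (p : preadditiveYoneda.obj X' ⟶ F),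
    ∀ Z : Cᵒᵖ, Function.Exact ((preadditiveYoneda.map f).app Z) (p.app Z) ∧
      Function.Surjective (p.app Z)

/-- The category `mod-C` of finitely presented `C`-modules and natural transformations. -/
abbrev FinPresMod := (finPresFunctor C).FullSubcategory

end Functors

/-- A category is a semisimple abelian category if it is abelian and all its objects are
projective. -/
def IsSemisimpleAbelian (C : Type w) [Category.{v} C] : Prop :=
  Nonempty (Abelian C) ∧ ∀ X : C, Projective X

/-- An `Ω_G`-algebra: the category of finitely presented modules over the stable category of
finitely generated Gorenstein projective right `Λ`-modules is semisimple abelian. -/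
def IsOmegaGAlgebra (Λ : Type u) [Ring Λ] : Prop :=
  IsSemisimpleAbelian (FinPresMod (StableGprj Λᵐᵒᵖ))

/-- `n`-Gorenstein rings: the injective dimension of `Λ`, both as a left and as a right
`Λ`-module, is at most `n`. -/
def IsIwanagaGorenstein (Λ : Type u) [Ring Λ] (n : ℕ) : Prop :=
  HasInjectiveDimensionLE (ModuleCat.of Λ Λ) n ∧
    HasInjectiveDimensionLE (ModuleCat.of Λᵐᵒᵖ Λ) n

end GProj

/-!
Throughout `A = Λᵐᵒᵖ`, so that right `Λ`-modules are left `A`-modules. Both conditions are reduced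
to statements about linear maps between finitely generated `A`-modules.

*The Gorenstein condition.* The module `Λ` has injective dimension at most `1` on a given side if
and only if `Ext¹(L, Λ) = 0` for all submodules `L` of projective modules on that side
(`hasInjectiveDimensionLE_one_iff`, `extVanish_of_hasInjectiveDimensionLE`). Transposing
presentation matrices, this condition for left `Λ`-modules says that every finitely generated
right module with `Ext¹(-, A) = 0` is torsionless (`torsionless_of_extVanish`,
`extVanish_ideal_of_torsionless`). Hence `Λ` is `1`-Gorenstein if and only if, for finitely
generated right modules, being torsionless is the same as having `Ext¹(-, A) = 0`
(`isIwanagaGorenstein_one_iff`), and in that case the Gorenstein projective modules are exactly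
the finitely generated torsionless ones (`TorsionlessIffExtVanish.gprj_iff`).

*The semisimplicity condition.* For a preadditive category `C`, the projection `C(-, Y) ⟶ coker
C(-, f)` splits if and only if `f = f ≫ s ≫ f` for some `s`. If all morphisms are regular in this
sense, the finitely presented functors are the retracts of the representable ones, and they form a
semisimple abelian category as soon as `C` has biproducts (`isRegularMor_of_projective`,
`isSemisimpleAbelian_finPresMod`). For the stable category, regularity means that each map `f`
between torsionless modules has an `s` for which `f - f s f` factors through a projective module.

*From regularity to summands of `rad Λ ⊕ Λ`.* Let `G` be torsionless. Then `G` is the kernel of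
some `P → X` with `P` projective and `Ext¹(X, A) = 0`, and up to a projective summand of `G` this
is a projective cover, so `G ⊆ rad P`. Regularity of the inclusion `i : G → rad P` gives `s` such
that `i (1 - s i)` extends to a map `P → rad P`. Such a map has no nonzero fixed point by
Nakayama's lemma, which makes `s i` invertible, and `G` a summand of `rad P` (`inAdd_of_gprj`).

*From summands of `rad Λ ⊕ Λ` to regularity.* Radicals of projective modules being Gorenstein
projective, they have `Ext¹(-, A) = 0` and admit cosyzygies. The class of such modules is closed
under extensions and summands. If `L` is in the class and `K` is a maximal submodule of `L`, then
`K` is a summand of the pullback of `L` and the projective cover of `L / K`, and this pullback is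
an extension of `L` by the radical of a projective module. Thus all submodules of free modules are
in the class, and `Λ` is `1`-Gorenstein (`torsionlessIffExtVanish_of_jacobson`). It remains to see
that all maps `X → Y` of torsionless modules are stably regular (`stablyRegular_of_inAdd`). This
goes by induction on the lengths, which allows `X` and `Y` to have local endomorphism rings and no
projective summands. The syzygies of `X` and `Y` are then summands of radicals of projective
modules with simple top. The map induced on syzygies either is regular for reasons of tops, or the
syzygy of `Y` is shorter than `X`, and the induction hypothesis applies to the next map in the
triangle of `X → Y`.
-/

namespace GProj

universe w v u

/-! ### Factorisations of linear maps -/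

section Factor

variable {A : Type*} [Ring A]

/-- A linear map vanishing on the kernel of a surjection descends along it. -/
lemma exists_desc {Y Z W : Type*} [AddCommGroup Y] [AddCommGroup Z] [AddCommGroup W]
    [Module A Y] [Module A Z] [Module A W] (s : Y →ₗ[A] Z) (hs : Function.Surjective s)
    (f : Y →ₗ[A] W) (h : ∀ y, s y = 0 → f y = 0) : ∃ g : Z →ₗ[A] W, ∀ y, g (s y) = f y := by
  have hle : LinearMap.ker s ≤ LinearMap.ker f := h
  refine ⟨(LinearMap.ker s).liftQ f hle ∘ₗ
    (s.quotKerEquivOfSurjective hs).symm.toLinearMap, fun y => ?_⟩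
  have : (s.quotKerEquivOfSurjective hs).symm (s y) = (LinearMap.ker s).mkQ y := by
    rw [LinearEquiv.symm_apply_eq]
    rfl
  rw [LinearMap.comp_apply, LinearEquiv.coe_coe, this, Submodule.mkQ_apply,
    Submodule.liftQ_apply]

/-- A linear map with values in the range of an injection factors through it. -/
lemma exists_factor {K Y W : Type*} [AddCommGroup K] [AddCommGroup Y] [AddCommGroup W]
    [Module A K] [Module A Y] [Module A W] (i : K →ₗ[A] Y) (hi : Function.Injective i)
    (f : W →ₗ[A] Y) (h : ∀ x, ∃ k, i k = f x) : ∃ g : W →ₗ[A] K, ∀ x, i (g x) = f x := by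
  refine ⟨(LinearEquiv.ofInjective i hi).symm.toLinearMap ∘ₗ
    f.codRestrict (LinearMap.range i) h, fun x => ?_⟩
  have := LinearEquiv.ofInjective_symm_apply (f := i) (h := hi) ⟨f x, h x⟩
  exact this

/-- Lifting along a surjection from a projective module. -/
lemma exists_lift {P Y Z : Type*} [AddCommGroup P] [AddCommGroup Y] [AddCommGroup Z]
    [Module A P] [Module A Y] [Module A Z] [Module.Projective A P] (s : Y →ₗ[A] Z)
    (hs : Function.Surjective s) (f : P →ₗ[A] Z) : ∃ g : P →ₗ[A] Y, ∀ x, s (g x) = f x := by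
  obtain ⟨g, hg⟩ := Module.projective_lifting_property s f hs
  exact ⟨g, fun x => LinearMap.congr_fun hg x⟩

/-- A finitely generated projective module is a retract of a free module of finite rank. -/
lemma exists_retract_pi (P : Type*) [AddCommGroup P] [Module A P] [Module.Finite A P]
    [Module.Projective A P] : ∃ (n : ℕ) (i : P →ₗ[A] (Fin n → A)) (r : (Fin n → A) →ₗ[A] P),
      ∀ x, r (i x) = x := by
  obtain ⟨n, r, hr⟩ := Module.Finite.exists_fin' A P
  obtain ⟨i, hi⟩ := exists_lift r hr LinearMap.id
  exact ⟨n, i, r, hi⟩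

end Factor

/-! ### Vanishing of the first extension group -/

section ExtVanish

variable {A : Type u} [Ring A]

/-- `Ext¹(X, A) = 0`, in the form: for every extension `Y` of `X`, each linear form on the kernel
of `Y → X` extends to `Y`. -/
def ExtVanish (A : Type u) [Ring A] (X : Type u) [AddCommGroup X] [Module A X] : Prop :=
  ∀ (Y : Type u) [AddCommGroup Y] [Module A Y] (s : Y →ₗ[A] X), Function.Surjective s →
    ∀ φ : LinearMap.ker s →ₗ[A] A, ∃ ψ : Y →ₗ[A] A, ∀ k : LinearMap.ker s, ψ k = φ k

/-- Linear forms on `M` separate its points. Over an artinian ring this means, for finitely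
generated `M`, that `M` is a submodule of a free module of finite rank. -/
def Torsionless (A : Type u) [Ring A] (M : Type u) [AddCommGroup M] [Module A M] : Prop :=
  ∀ x : M, x ≠ 0 → ∃ f : M →ₗ[A] A, f x ≠ 0

variable {X Y Z P Q K : Type u} [AddCommGroup X] [Module A X] [AddCommGroup Y] [Module A Y]
  [AddCommGroup Z] [Module A Z] [AddCommGroup P] [Module A P] [AddCommGroup Q] [Module A Q]
  [AddCommGroup K] [Module A K]

lemma ExtVanish.extend (h : ExtVanish A X) (i : K →ₗ[A] Y) (hi : Function.Injective i)
    (s : Y →ₗ[A] X) (hs : Function.Surjective s) (he : Function.Exact i s) (φ : K →ₗ[A] A) :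
    ∃ ψ : Y →ₗ[A] A, ∀ k, ψ (i k) = φ k := by
  obtain ⟨g, hg⟩ := exists_factor i hi (LinearMap.ker s).subtype (fun x => (he x).1 x.2)
  obtain ⟨ψ, hψ⟩ := h Y s hs (φ ∘ₗ g)
  refine ⟨ψ, fun k => ?_⟩
  have hk : i k ∈ LinearMap.ker s := (he _).2 ⟨k, rfl⟩
  have := hψ ⟨i k, hk⟩
  rw [this]
  change φ (g ⟨i k, hk⟩) = _
  rw [hi (hg ⟨i k, hk⟩)]

/-- If `Ext¹(X, A) = 0` then also `Ext¹(X, Q) = 0` for finitely generated projective `Q`. -/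
lemma ExtVanish.extend_proj (h : ExtVanish A X) (i : K →ₗ[A] Y) (hi : Function.Injective i)
    (s : Y →ₗ[A] X) (hs : Function.Surjective s) (he : Function.Exact i s)
    [Module.Finite A Q] [Module.Projective A Q] (φ : K →ₗ[A] Q) :
    ∃ ψ : Y →ₗ[A] Q, ∀ k, ψ (i k) = φ k := by
  obtain ⟨n, j, r, hr⟩ := exists_retract_pi (A := A) Q
  choose ψ hψ using fun t : Fin n => h.extend i hi s hs he (LinearMap.proj t ∘ₗ j ∘ₗ φ)
  refine ⟨r ∘ₗ LinearMap.pi ψ, fun k => ?_⟩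
  have : LinearMap.pi ψ (i k) = j (φ k) := by
    ext t
    exact hψ t k
  simp [this, hr]

/-- The vanishing of `Ext¹(X, A)` can be tested on one projective presentation. -/
lemma extVanish_of_projective [Module.Projective A P] (i : K →ₗ[A] P) (p : P →ₗ[A] X)
    (hp : Function.Surjective p) (he : Function.Exact i p)
    (h : ∀ φ : K →ₗ[A] A, ∃ ψ : P →ₗ[A] A, ∀ k, ψ (i k) = φ k) : ExtVanish A X := by
  intro Y _ _ s hs φ
  obtain ⟨g, hg⟩ := exists_lift s hs p
  have hgi : ∀ k, g (i k) ∈ LinearMap.ker s := fun k => by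
    rw [LinearMap.mem_ker, hg]
    exact (he _).2 ⟨k, rfl⟩
  obtain ⟨χ, hχ⟩ := h (φ ∘ₗ (g ∘ₗ i).codRestrict _ hgi)
  -- `Y` is the pushout of `ker s` and `P` along `K`.
  let q : LinearMap.ker s × P →ₗ[A] Y := (LinearMap.ker s).subtype.coprod g
  have hq : Function.Surjective q := fun y => by
    obtain ⟨x, hx⟩ := hp (s y)
    refine ⟨(⟨y - g x, by simp [hg, hx]⟩, x), by simp [q]⟩
  obtain ⟨ψ, hψ⟩ := exists_desc q hq (φ.coprod χ) (by
    rintro ⟨⟨y, hy⟩, x⟩ h0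
    have h0 : y + g x = 0 := by simpa [q] using h0
    have hx : p x = 0 := by
      rw [← hg, ← neg_eq_of_add_eq_zero_right h0, map_neg, LinearMap.mem_ker.1 hy, neg_zero]
    obtain ⟨k, rfl⟩ := (he x).1 hx
    have : (⟨y, hy⟩ : LinearMap.ker s) = -⟨g (i k), hgi k⟩ :=
      Subtype.ext (eq_neg_of_add_eq_zero_left h0)
    simp only [LinearMap.coprod_apply, hχ, this, map_neg]
    exact neg_add_cancel _)
  refine ⟨ψ, fun k => ?_⟩
  have := hψ (k, 0)
  simpa [q] using this

/-- The class of modules with `Ext¹(-, A) = 0` is closed under extensions. -/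
lemma ExtVanish.extension (hX : ExtVanish A X) (hZ : ExtVanish A Z) (i : X →ₗ[A] Y)
    (hi : Function.Injective i) (p : Y →ₗ[A] Z) (hp : Function.Surjective p)
    (he : Function.Exact i p) : ExtVanish A Y := by
  intro W _ _ s hs φ
  let V := LinearMap.ker (p ∘ₗ s)
  obtain ⟨t, ht⟩ := exists_factor i hi (s ∘ₗ V.subtype) (fun x => (he _).1 x.2)
  have hle : LinearMap.ker s ≤ V := fun x hx => by
    change p (s x) = 0
    rw [LinearMap.mem_ker.1 hx, map_zero]
  obtain ⟨χ, hχ⟩ := hX.extend (Submodule.inclusion hle) (Submodule.inclusion_injective hle) t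
    (fun x => by
      obtain ⟨y, hy⟩ := hs (i x)
      refine ⟨⟨y, ?_⟩, hi ?_⟩
      · change p (s y) = 0
        rw [hy]
        exact (he _).2 ⟨x, rfl⟩
      · rw [ht]
        exact hy)
    (fun x => by
      constructor
      · intro hx
        refine ⟨⟨x, ?_⟩, rfl⟩
        rw [LinearMap.mem_ker]
        have := ht x
        rw [hx, map_zero] at this
        exact this.symm
      · rintro ⟨k, rfl⟩
        apply hi
        rw [ht, map_zero]
        exact k.2) φ
  obtain ⟨ψ, hψ⟩ := hZ W (p ∘ₗ s) (hp.comp hs) χ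
  exact ⟨ψ, fun k => (hψ (Submodule.inclusion hle k)).trans (hχ k)⟩

lemma ExtVanish.of_retract (h : ExtVanish A Y) (i : X →ₗ[A] Y) (r : Y →ₗ[A] X)
    (hr : ∀ x, r (i x) = x) : ExtVanish A X := by
  intro W _ _ s hs φ
  let V := LinearMap.ker (s.coprod (-r))
  have hmem : ∀ k : LinearMap.ker s, ((k : W), (0 : Y)) ∈ V := fun k => by
    simp [V]
  have hV : ∀ v : V, s v.1.1 = r v.1.2 := fun v => by
    have := v.2
    simp only [V, LinearMap.mem_ker, LinearMap.coprod_apply, LinearMap.neg_apply] at this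
    exact add_neg_eq_zero.1 this
  obtain ⟨ψ, hψ⟩ := h.extend
    ((LinearMap.inl A W Y ∘ₗ (LinearMap.ker s).subtype).codRestrict V hmem)
    (fun a b hab => by
      have := congrArg (fun v : V => v.1.1) hab
      exact Subtype.ext this)
    (LinearMap.snd A W Y ∘ₗ V.subtype)
    (fun y => by
      obtain ⟨x, hx⟩ := hs (r y)
      exact ⟨⟨(x, y), by simp [V, hx]⟩, rfl⟩)
    (fun v => by
      constructor
      · intro hv
        have hv : v.1.2 = 0 := hv
        refine ⟨⟨v.1.1, ?_⟩, ?_⟩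
        · rw [LinearMap.mem_ker, hV, hv, map_zero]
        · exact Subtype.ext (Prod.ext rfl hv.symm)
      · rintro ⟨k, rfl⟩
        rfl) φ
  refine ⟨ψ ∘ₗ (LinearMap.id.prod (i ∘ₗ s)).codRestrict V (fun x => by simp [V, hr]),
    fun k => ?_⟩
  rw [← hψ k]
  refine congrArg ψ (Subtype.ext (Prod.ext rfl ?_))
  change i (s k) = 0
  rw [LinearMap.mem_ker.1 k.2, map_zero]

lemma ExtVanish.of_equiv (h : ExtVanish A Y) (e : X ≃ₗ[A] Y) : ExtVanish A X :=
  h.of_retract e.toLinearMap e.symm.toLinearMap (fun x => e.symm_apply_apply x)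

/-! ### Torsionless modules -/

lemma Torsionless.of_injective (h : Torsionless A Y) (i : X →ₗ[A] Y)
    (hi : Function.Injective i) : Torsionless A X := fun x hx => by
  obtain ⟨f, hf⟩ := h (i x) (fun h0 => hx (hi (by rw [h0, map_zero])))
  exact ⟨f ∘ₗ i, hf⟩

lemma torsionless_projective [Module.Projective A P] : Torsionless A P := fun x hx => by
  obtain ⟨s, hs⟩ := Module.projective_def'.1 (inferInstance : Module.Projective A P)
  have h1 : s x ≠ 0 := fun h0 => hx (by
    have := LinearMap.congr_fun hs x
    rw [LinearMap.comp_apply, h0, map_zero] at this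
    exact this.symm)
  obtain ⟨t, ht⟩ := Finsupp.ne_iff.1 h1
  exact ⟨Finsupp.lapply t ∘ₗ s, ht⟩

lemma Torsionless.prod {M N : Type u} [AddCommGroup M] [Module A M] [AddCommGroup N] [Module A N]
    (hM : Torsionless A M) (hN : Torsionless A N) : Torsionless A (M × N) := by
  rintro ⟨m, n⟩ hmn
  by_cases hm : m = 0
  · obtain ⟨f, hf⟩ := hN n (by rintro rfl; exact hmn (by rw [hm]; rfl))
    exact ⟨f ∘ₗ LinearMap.snd A M N, hf⟩
  · obtain ⟨f, hf⟩ := hM m hm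
    exact ⟨f ∘ₗ LinearMap.fst A M N, hf⟩

/-- An extension of torsionless modules is torsionless if `Ext¹` of the quotient vanishes. -/
lemma Torsionless.extension (hX : Torsionless A X) (hZ : Torsionless A Z) (hZ' : ExtVanish A Z)
    (i : X →ₗ[A] Y) (hi : Function.Injective i) (p : Y →ₗ[A] Z) (hp : Function.Surjective p)
    (he : Function.Exact i p) : Torsionless A Y := fun y hy => by
  by_cases h : p y = 0
  · obtain ⟨x, rfl⟩ := (he y).1 h
    obtain ⟨f, hf⟩ := hX x (fun h0 => hy (by rw [h0, map_zero]))
    obtain ⟨g, hg⟩ := hZ'.extend i hi p hp he f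
    exact ⟨g, by rwa [hg]⟩
  · obtain ⟨f, hf⟩ := hZ _ h
    exact ⟨f ∘ₗ p, hf⟩

end ExtVanish

/-! ### Injective dimension at most one -/

section InjDim

variable {A : Type u} [Ring A]

/-- If the cokernel of an embedding of `A` into an injective module is injective, then
`Ext¹(L, A) = Ext²(P ⧸ L, A) = 0` for each submodule `L` of a projective module `P`. -/
lemma extVanish_of_injective_cokernel {I J : Type u} [AddCommGroup I] [Module A I]
    [AddCommGroup J] [Module A J] (i : A →ₗ[A] I) (hi : Function.Injective i) (q : I →ₗ[A] J)
    (hq : Function.Surjective q) (he : Function.Exact i q) (hI : Module.Injective A I)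
    (hJ : Module.Injective A J) {L P : Type u} [AddCommGroup L] [Module A L] [AddCommGroup P]
    [Module A P] [Module.Projective A P] (l : L →ₗ[A] P) (hl : Function.Injective l) :
    ExtVanish A L := by
  intro Y _ _ s hs φ
  obtain ⟨g, hg⟩ := hI.out (LinearMap.ker s).subtype (Subtype.val_injective) (i ∘ₗ φ)
  obtain ⟨h, hh⟩ := exists_desc s hs (q ∘ₗ g) (fun y hy => by
    have : g y = i (φ ⟨y, hy⟩) := hg ⟨y, hy⟩
    rw [LinearMap.comp_apply, this]
    exact (he _).2 ⟨_, rfl⟩)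
  obtain ⟨h', hh'⟩ := hJ.out l hl h
  obtain ⟨f, hf⟩ := exists_lift q hq h'
  obtain ⟨ψ, hψ⟩ := exists_factor i hi (g - f ∘ₗ l ∘ₗ s) (fun y => (he _).1 (by
    simp [hf, hh', hh]))
  refine ⟨ψ, fun k => hi ?_⟩
  rw [hψ]
  have : g k = i (φ k) := hg k
  simp [this]

lemma injective_cokernel_of_extVanish {I J : Type u} [AddCommGroup I] [Module A I]
    [AddCommGroup J] [Module A J] (i : A →ₗ[A] I) (hi : Function.Injective i) (q : I →ₗ[A] J)
    (hq : Function.Surjective q) (he : Function.Exact i q) (hI : Module.Injective A I)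
    (h : ∀ L : Ideal A, ExtVanish A L) : Module.Injective A J := by
  refine Module.Baer.injective fun L g => ?_
  let V := LinearMap.ker (g.coprod (-q))
  have hV : ∀ v : V, g v.1.1 = q v.1.2 := fun v => by
    have := v.2
    simp only [V, LinearMap.mem_ker, LinearMap.coprod_apply, LinearMap.neg_apply] at this
    exact add_neg_eq_zero.1 this
  have hmem : ∀ a : A, ((0 : L), i a) ∈ V := fun a => by
    have : q (i a) = 0 := (he _).2 ⟨a, rfl⟩
    simp [V, this]
  obtain ⟨ψ, hψ⟩ := (h L).extend ((LinearMap.inr A L I ∘ₗ i).codRestrict V hmem)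
    (fun a b hab => hi (congrArg (fun v : V => v.1.2) hab))
    (LinearMap.fst A L I ∘ₗ V.subtype)
    (fun y => by
      obtain ⟨x, hx⟩ := hq (g y)
      exact ⟨⟨(y, x), by simp [V, hx]⟩, rfl⟩)
    (fun v => by
      constructor
      · intro hv
        have hv : v.1.1 = 0 := hv
        have := hV v
        rw [hv, map_zero] at this
        obtain ⟨a, ha⟩ := (he _).1 this.symm
        exact ⟨a, Subtype.ext (Prod.ext hv.symm ha)⟩
      · rintro ⟨k, rfl⟩
        rfl) LinearMap.id
  -- `ψ` splits off `A` from the pullback `V`, so that `g` lifts to `I`.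
  obtain ⟨f, hf⟩ := exists_desc (LinearMap.fst A L I ∘ₗ V.subtype)
    (fun y => by
      obtain ⟨x, hx⟩ := hq (g y)
      exact ⟨⟨(y, x), by simp [V, hx]⟩, rfl⟩)
    (LinearMap.snd A L I ∘ₗ V.subtype - i ∘ₗ ψ) (fun v hv => by
      have hv : v.1.1 = 0 := hv
      have h1 := hV v
      rw [hv, map_zero] at h1
      obtain ⟨a, ha⟩ := (he _).1 h1.symm
      have h2 : v = (LinearMap.inr A L I ∘ₗ i).codRestrict V hmem a :=
        Subtype.ext (Prod.ext hv ha.symm)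
      have h3 : ψ v = a := by rw [h2, hψ]; rfl
      simp [h3, ha])
  obtain ⟨F, hF⟩ := hI.out L.subtype Subtype.val_injective f
  refine ⟨q ∘ₗ F, fun x hx => ?_⟩
  have h1 : F x = f ⟨x, hx⟩ := hF ⟨x, hx⟩
  obtain ⟨y, hy⟩ := hq (g ⟨x, hx⟩)
  have h2 := hf ⟨(⟨x, hx⟩, y), by simp [V, hy]⟩
  have h2 : f ⟨x, hx⟩ = y - i (ψ ⟨(⟨x, hx⟩, y), by simp [V, hy]⟩) := h2
  have h3 : ∀ a, q (i a) = 0 := fun a => (he _).2 ⟨a, rfl⟩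
  rw [LinearMap.comp_apply, h1, h2, map_sub, h3, sub_zero, hy]

/-- An embedding of `A` into an injective module detects injective dimension at most one. -/
lemma exists_injective_cokernel (A : Type u) [Ring A] :
    ∃ (I J : ModuleCat.{u} A) (i : A →ₗ[A] I) (q : I →ₗ[A] J), Function.Injective i ∧
      Function.Surjective q ∧ Function.Exact i q ∧ Module.Injective A I ∧
      (HasInjectiveDimensionLE (ModuleCat.of A A) 1 ↔ Module.Injective A J) := by
  let X := ModuleCat.of A A
  let f := Injective.ι X
  let S := ShortComplex.mk f (Limits.cokernel.π f) (Limits.cokernel.condition f)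
  have hS : S.ShortExact := { exact := ShortComplex.exact_cokernel f }
  refine ⟨S.X₂, S.X₃, S.f.hom, S.g.hom, ?_, ?_, ?_, ?_, ?_⟩
  · exact (ModuleCat.mono_iff_injective S.f).1 hS.mono_f
  · exact (ModuleCat.epi_iff_surjective S.g).1 hS.epi_g
  · exact (ShortComplex.ShortExact.moduleCat_exact_iff_function_exact S).1 hS.exact
  · exact Module.injective_module_of_injective_object A _ (inj := inferInstanceAs
      (Injective (Injective.under X)))
  · have h := hS.hasInjectiveDimensionLT_X₃_iff 0 (inferInstanceAs (Injective (Injective.under X)))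
    rw [← injective_iff_hasInjectiveDimensionLT_one] at h
    refine h.symm.trans ?_
    exact ⟨fun h => Module.injective_module_of_injective_object A S.X₃ (inj := h),
      fun h => Module.injective_object_of_injective_module A S.X₃ (inj := h)⟩

/-- The regular module has injective dimension at most one if and only if
`Ext¹(L, A) = Ext²(A ⧸ L, A)` vanishes for all left ideals `L`. -/
lemma hasInjectiveDimensionLE_one_iff :
    HasInjectiveDimensionLE (ModuleCat.of A A) 1 ↔ ∀ L : Ideal A, ExtVanish A L := by
  obtain ⟨I, J, i, q, hi, hq, he, hI, h⟩ := exists_injective_cokernel A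
  rw [h]
  exact ⟨fun hJ L => extVanish_of_injective_cokernel i hi q hq he hI hJ L.subtype
    Subtype.val_injective, injective_cokernel_of_extVanish i hi q hq he hI⟩

lemma extVanish_of_hasInjectiveDimensionLE (h : HasInjectiveDimensionLE (ModuleCat.of A A) 1)
    {L P : Type u} [AddCommGroup L] [Module A L] [AddCommGroup P] [Module A P]
    [Module.Projective A P] (l : L →ₗ[A] P) (hl : Function.Injective l) : ExtVanish A L := by
  obtain ⟨I, J, i, q, hi, hq, he, hI, h'⟩ := exists_injective_cokernel A
  exact extVanish_of_injective_cokernel i hi q hq he hI (h'.1 h) l hl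

end InjDim

/-! ### Transposition between left and right modules -/

section Transpose

open MulOpposite

variable {Λ : Type u} [Ring Λ]

lemma exists_fin_span {A M : Type*} [Ring A] [AddCommGroup M] [Module A M] [IsNoetherian A M]
    (L : Submodule A M) : ∃ (n : ℕ) (k : Fin n → M), LinearMap.range
      (Fintype.linearCombination A k) = L := by
  obtain ⟨n, k, hk⟩ := Submodule.fg_iff_exists_fin_generating_family.1 (IsNoetherian.noetherian L)
  exact ⟨n, k, by rw [Fintype.range_linearCombination, hk]⟩

lemma linearMap_eq_linearCombination {A M : Type*} [Ring A] [AddCommGroup M] [Module A M] {n : ℕ}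
    (f : (Fin n → A) →ₗ[A] M) :
    f = Fintype.linearCombination A (fun i => f (Pi.single i 1)) := by
  refine LinearMap.pi_ext' fun i => LinearMap.ext_ring ?_
  simp [Fintype.linearCombination_apply_single]

/-- If left `Λ`-submodules of free modules have vanishing `Ext¹(-, Λ)`, then right modules with
vanishing `Ext¹(-, Λ)` are torsionless: a relation matrix of such a module `N` presents on the
other side a submodule of a free module, whose `Ext¹` is the kernel of the evaluation map
of `N` into its double dual. -/
lemma torsionless_of_extVanish [IsNoetherianRing Λᵐᵒᵖ]
    (h : ∀ (c : ℕ) (L : Submodule Λ (Fin c → Λ)), ExtVanish Λ L)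
    (N : Type u) [AddCommGroup N] [Module Λᵐᵒᵖ N] [Module.Finite Λᵐᵒᵖ N]
    (hN : ExtVanish Λᵐᵒᵖ N) : Torsionless Λᵐᵒᵖ N := by
  intro n hn
  obtain ⟨b, p, hp⟩ := Module.Finite.exists_fin' Λᵐᵒᵖ N
  obtain ⟨x, rfl⟩ := hp n
  by_contra! H
  apply hn
  obtain ⟨a, k, hk⟩ := exists_fin_span (LinearMap.ker p)
  have hpk : ∀ i, p (k i) = 0 := fun i => by
    have : k i ∈ LinearMap.ker p := by
      rw [← hk]
      exact ⟨Pi.single i 1, by simp [Fintype.linearCombination_apply_single]⟩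
    exact this
  -- The transposed relation matrix, and the linear form on its image defined by `x`.
  let κ : (Fin b → Λ) →ₗ[Λ] (Fin a → Λ) :=
    Fintype.linearCombination Λ (fun j i => unop (k i j))
  have hκ : ∀ t i, κ t i = ∑ j, t j * unop (k i j) := fun t i => by
    simp [κ, Fintype.linearCombination_apply]
  obtain ⟨φ, hφ⟩ := exists_desc κ.rangeRestrict κ.surjective_rangeRestrict
    (Fintype.linearCombination Λ (fun j => unop (x j))) (fun t ht => by
      have ht : κ t = 0 := congrArg Subtype.val ht
      let F : (Fin b → Λᵐᵒᵖ) →ₗ[Λᵐᵒᵖ] Λᵐᵒᵖ :=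
        Fintype.linearCombination Λᵐᵒᵖ (fun j => op (t j))
      have hF : ∀ v, F v = op (∑ j, t j * unop (v j)) := fun v => by
        simp [F, Fintype.linearCombination_apply]
      obtain ⟨f, hf⟩ := exists_desc p hp F (fun v hv => by
        have hv : v ∈ LinearMap.ker p := hv
        rw [← hk] at hv
        obtain ⟨y, rfl⟩ := hv
        rw [Fintype.linearCombination_apply Λᵐᵒᵖ k y, map_sum]
        refine Finset.sum_eq_zero fun i _ => ?_
        rw [map_smul, hF, ← hκ, ht]
        simp)
      have h1 := H f
      rw [hf, hF] at h1
      rw [Fintype.linearCombination_apply]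
      exact op_injective (h1.trans op_zero.symm))
  -- The image of the transposed matrix is the kernel of a matrix of syzygies.
  obtain ⟨c, y, hy⟩ := exists_fin_span
    (LinearMap.ker (Fintype.linearCombination Λᵐᵒᵖ k))
  let ρ : (Fin a → Λ) →ₗ[Λ] (Fin c → Λ) :=
    Fintype.linearCombination Λ (fun i l => unop (y l i))
  have hρ : ∀ z l, ρ z l = ∑ i, z i * unop (y l i) := fun z l => by
    simp [ρ, Fintype.linearCombination_apply]
  have hex : Function.Exact (LinearMap.range κ).subtype ρ.rangeRestrict := by
    intro z
    constructor
    · intro hz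
      have hz : ρ z = 0 := congrArg Subtype.val hz
      obtain ⟨χ, hχ⟩ := exists_desc (Fintype.linearCombination Λᵐᵒᵖ k).rangeRestrict
        (LinearMap.surjective_rangeRestrict _)
        (Fintype.linearCombination Λᵐᵒᵖ (fun i => op (z i))) (fun v hv => by
          have hv : v ∈ LinearMap.ker (Fintype.linearCombination Λᵐᵒᵖ k) :=
            congrArg Subtype.val hv
          rw [← hy] at hv
          obtain ⟨s, rfl⟩ := hv
          rw [Fintype.linearCombination_apply Λᵐᵒᵖ y s, map_sum]
          refine Finset.sum_eq_zero fun l _ => ?_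
          have : Fintype.linearCombination Λᵐᵒᵖ (fun i => op (z i)) (y l) = op (ρ z l) := by
            simp [hρ, Fintype.linearCombination_apply]
          rw [map_smul, this, hz]
          simp)
      obtain ⟨ψ, hψ⟩ := hN.extend (LinearMap.range (Fintype.linearCombination Λᵐᵒᵖ k)).subtype
        Subtype.val_injective p hp (fun v => by
          rw [← LinearMap.mem_ker, ← hk]
          simp) χ
      refine ⟨⟨_, LinearMap.mem_range_self κ (fun j => unop (ψ (Pi.single j 1)))⟩, ?_⟩
      funext i
      have h1 := hχ (Pi.single i 1)
      rw [← hψ] at h1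
      have h2 : ((Fintype.linearCombination Λᵐᵒᵖ k).rangeRestrict (Pi.single i 1) :
          Fin b → Λᵐᵒᵖ) = k i := by
        simp [Fintype.linearCombination_apply_single]
      rw [Submodule.subtype_apply, h2, linearMap_eq_linearCombination ψ] at h1
      simp only [Fintype.linearCombination_apply_single, one_smul] at h1
      apply op_injective
      rw [← h1]
      simp [hκ, Fintype.linearCombination_apply]
    · rintro ⟨⟨_, t, rfl⟩, rfl⟩
      apply Subtype.ext
      funext l
      change ρ (κ t) l = 0
      have h1 : Fintype.linearCombination Λᵐᵒᵖ k (y l) = 0 := by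
        have : y l ∈ LinearMap.ker (Fintype.linearCombination Λᵐᵒᵖ k) := by
          rw [← hy]
          exact ⟨Pi.single l 1, by simp [Fintype.linearCombination_apply_single]⟩
        exact this
      rw [hρ]
      simp only [hκ, Finset.sum_mul]
      rw [Finset.sum_comm]
      refine Finset.sum_eq_zero fun j _ => ?_
      have h2 := congrArg unop (congrFun h1 j)
      simp only [Fintype.linearCombination_apply, Finset.sum_apply, Pi.smul_apply, smul_eq_mul,
        Finset.unop_sum, unop_mul, Pi.zero_apply, unop_zero] at h2
      simp only [mul_assoc]
      rw [← Finset.mul_sum, h2, mul_zero]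
  obtain ⟨ψ, hψ⟩ := (h c (LinearMap.range ρ)).extend _ Subtype.val_injective _
    ρ.surjective_rangeRestrict hex φ
  have hx : x = Fintype.linearCombination Λᵐᵒᵖ k (fun i => op (ψ (Pi.single i 1))) := by
    funext j
    have h1 := hφ (Pi.single j 1)
    rw [← hψ, linearMap_eq_linearCombination ψ] at h1
    simp only [Fintype.linearCombination_apply_single, one_smul] at h1
    apply unop_injective
    rw [← h1]
    simp [hκ, Fintype.linearCombination_apply, Pi.single_apply]
  rw [hx, Fintype.linearCombination_apply, map_sum]
  exact Finset.sum_eq_zero fun i _ => by rw [map_smul, hpk, smul_zero]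

/-- Conversely, if right modules with vanishing `Ext¹(-, Λ)` are torsionless, then `Ext¹(-, Λ)`
vanishes on left ideals. -/
lemma extVanish_ideal_of_torsionless [IsNoetherianRing Λ]
    (h : ∀ (N : Type u) [AddCommGroup N] [Module Λᵐᵒᵖ N] [Module.Finite Λᵐᵒᵖ N],
      ExtVanish Λᵐᵒᵖ N → Torsionless Λᵐᵒᵖ N) (I : Ideal Λ) : ExtVanish Λ I := by
  obtain ⟨a, y, rfl⟩ := exists_fin_span I
  let p := Fintype.linearCombination Λ y
  obtain ⟨b, k, hk⟩ := exists_fin_span (LinearMap.ker p)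
  refine extVanish_of_projective (LinearMap.ker p).subtype p.rangeRestrict
    p.surjective_rangeRestrict (fun v => ?_) (fun φ => ?_)
  · simp [← LinearMap.mem_ker]
  have hpk : ∀ j, k j ∈ LinearMap.ker p := fun j => by
    rw [← hk]
    exact ⟨Pi.single j 1, by simp [Fintype.linearCombination_apply_single]⟩
  let K : Fin a → Fin b → Λᵐᵒᵖ := fun i j => op (k j i)
  let κ := Fintype.linearCombination Λᵐᵒᵖ K
  have hκ : ∀ c j, κ c j = op (∑ i, k j i * unop (c i)) := fun c j => by
    simp [κ, K, Fintype.linearCombination_apply]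
  have hK : ∀ i, K i = κ (Pi.single i 1) := fun i => by
    simp [κ, Fintype.linearCombination_apply_single]
  have hlin : ∀ (f : (Fin b → Λᵐᵒᵖ) →ₗ[Λᵐᵒᵖ] Λᵐᵒᵖ) i,
      f (K i) = op (∑ j, unop (f (Pi.single j 1)) * k j i) := fun f i => by
    conv_lhs => rw [linearMap_eq_linearCombination f]
    simp [K, Fintype.linearCombination_apply]
  have hN : ExtVanish Λᵐᵒᵖ ((Fin b → Λᵐᵒᵖ) ⧸ LinearMap.range κ) := by
    refine extVanish_of_projective (LinearMap.range κ).subtype (LinearMap.range κ).mkQ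
      (Submodule.mkQ_surjective _) (fun v => by simp) (fun χ => ?_)
    let z : Fin a → Λ := fun i => unop (χ (κ.rangeRestrict (Pi.single i 1)))
    have hz : z ∈ LinearMap.ker p := by
      have h1 : κ (fun i => op (y i)) = 0 := by
        funext j
        rw [hκ]
        have := hpk j
        rw [LinearMap.mem_ker, Fintype.linearCombination_apply] at this
        exact congrArg op this
      have h2 : χ (κ.rangeRestrict (fun i => op (y i))) = 0 := by
        rw [show κ.rangeRestrict (fun i => op (y i)) = 0 from Subtype.ext h1, map_zero]
      have h3 : (χ ∘ₗ κ.rangeRestrict) (fun i => op (y i)) = 0 := h2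
      rw [linearMap_eq_linearCombination (χ ∘ₗ κ.rangeRestrict),
        Fintype.linearCombination_apply] at h3
      have h4 := congrArg unop h3
      simpa [p, z, Fintype.linearCombination_apply] using h4
    rw [← hk] at hz
    obtain ⟨t, ht⟩ := hz
    refine ⟨Fintype.linearCombination Λᵐᵒᵖ (fun j => op (t j)), ?_⟩
    have h5 : (Fintype.linearCombination Λᵐᵒᵖ (fun j => op (t j))) ∘ₗ κ =
        χ ∘ₗ κ.rangeRestrict := by
      refine LinearMap.pi_ext' fun i => LinearMap.ext_ring ?_
      have := congrFun ht i
      simp only [Fintype.linearCombination_apply, Finset.sum_apply, Pi.smul_apply,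
        smul_eq_mul] at this
      change (Fintype.linearCombination Λᵐᵒᵖ (fun j => op (t j))) (κ (Pi.single i 1)) =
        χ (κ.rangeRestrict (Pi.single i 1))
      rw [← hK, hlin]
      simp only [Fintype.linearCombination_apply_single, one_smul, unop_op, this, z, op_unop]
    rintro ⟨_, v, rfl⟩
    exact LinearMap.congr_fun h5 v
  let x : Fin b → Λᵐᵒᵖ := fun j => op (φ ⟨k j, hpk j⟩)
  have hx : x ∈ LinearMap.range κ := by
    rw [← Submodule.Quotient.mk_eq_zero]
    by_contra hne
    obtain ⟨f, hf⟩ := h _ hN _ hne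
    apply hf
    let F := f ∘ₗ (LinearMap.range κ).mkQ
    have h1 : ∀ i, F (K i) = 0 := fun i => by
      have : (LinearMap.range κ).mkQ (K i) = 0 := by
        rw [Submodule.mkQ_apply, Submodule.Quotient.mk_eq_zero, hK]
        exact LinearMap.mem_range_self _ _
      rw [LinearMap.comp_apply, this, map_zero]
    have h2 : ∑ j, unop (F (Pi.single j 1)) • (⟨k j, hpk j⟩ : LinearMap.ker p) = 0 := by
      apply Subtype.ext
      funext i
      have := h1 i
      rw [hlin] at this
      simpa using op_injective (this.trans op_zero.symm)
    have h3 := congrArg φ h2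
    rw [map_sum, map_zero] at h3
    change F x = 0
    rw [linearMap_eq_linearCombination F, Fintype.linearCombination_apply]
    apply unop_injective
    simp only [map_smul] at h3
    simpa [x] using h3
  obtain ⟨c, hc⟩ := hx
  let ψ := Fintype.linearCombination Λ (fun i => unop (c i))
  have hψ : ∀ j, ψ (k j) = φ ⟨k j, hpk j⟩ := fun j => by
    have := congrArg unop (congrFun hc j)
    rw [hκ] at this
    simpa [ψ, x, Fintype.linearCombination_apply] using this
  refine ⟨ψ, fun v => ?_⟩
  obtain ⟨t, ht⟩ : (v : Fin a → Λ) ∈ LinearMap.range (Fintype.linearCombination Λ k) := by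
    rw [hk]
    exact v.2
  have hv : v = ∑ j, t j • (⟨k j, hpk j⟩ : LinearMap.ker p) := by
    apply Subtype.ext
    rw [← ht, Fintype.linearCombination_apply]
    simp
  rw [hv, map_sum, map_sum, map_sum]
  exact Finset.sum_congr rfl fun j _ => by
    rw [map_smul, Submodule.subtype_apply, map_smul, map_smul, hψ]

end Transpose

section Gorenstein

variable {A : Type u} [Ring A]

/-! ### Constructing and dismantling totally acyclic complexes -/

/-- A short exact sequence `0 → M → P → N → 0` with `P` finitely generated projective which stays
exact under `Hom(-, A)`. -/
def HasSyzygySequence (M N : ModuleCat.{u} A) : Prop :=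
  ∃ (P : ModuleCat.{u} A) (i : M →ₗ[A] P) (p : P →ₗ[A] N), Module.Finite A P ∧
    Module.Projective A P ∧ Function.Injective i ∧ Function.Surjective p ∧ Function.Exact i p ∧
    ∀ φ : M →ₗ[A] A, ∃ ψ : P →ₗ[A] A, ∀ x, ψ (i x) = φ x

/-- A doubly infinite sequence of syzygy sequences can be spliced to a totally acyclic complex. -/
lemma gprj_of_sequence (N : ℤ → ModuleCat.{u} A) (h : ∀ i, HasSyzygySequence (N i) (N (i + 1)))
    (h0 : Module.Finite A (N 0)) : gprj A (N 0) := by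
  choose P i p hfin hproj hi hp he hext using h
  refine ⟨h0, ⟨P, fun n => i (n + 1) ∘ₗ p n, hfin, hproj, fun n y => ?_, fun n φ => ?_⟩, 0, ?_⟩
  · constructor
    · intro hy
      have hy : i (n + 1 + 1) (p (n + 1) y) = 0 := hy
      rw [map_eq_zero_iff _ (hi _)] at hy
      obtain ⟨x, rfl⟩ := (he _ _).1 hy
      obtain ⟨z, rfl⟩ := hp _ x
      exact ⟨z, rfl⟩
    · rintro ⟨z, rfl⟩
      change i (n + 1 + 1) (p (n + 1) (i (n + 1) (p n z))) = 0
      rw [(he (n + 1) _).2 ⟨_, rfl⟩, map_zero]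
  · constructor
    · intro hφ
      have h1 : ∀ x, φ (i (n + 1) x) = 0 := fun x => by
        obtain ⟨z, rfl⟩ := hp _ x
        exact LinearMap.congr_fun hφ z
      obtain ⟨ψ, hψ⟩ := exists_desc (p (n + 1)) (hp _) φ (fun y hy => by
        obtain ⟨x, rfl⟩ := (he _ _).1 hy
        exact h1 x)
      obtain ⟨χ, hχ⟩ := hext _ ψ
      exact ⟨χ, LinearMap.ext fun y => (hχ _).trans (hψ y)⟩
    · rintro ⟨χ, rfl⟩
      refine LinearMap.ext fun z => ?_
      change χ (i (n + 1 + 1) (p (n + 1) (i (n + 1) (p n z)))) = 0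
      rw [(he (n + 1) _).2 ⟨_, rfl⟩, map_zero, map_zero]
  · refine ⟨(LinearEquiv.ofInjective (i 0) (hi 0)).trans (LinearEquiv.ofEq _ _ ?_)⟩
    ext y
    rw [LinearMap.mem_ker, LinearMap.comp_apply, map_eq_zero_iff _ (hi _), (he 0 y)]
    rfl

/-- Coinduction principle for Gorenstein projective modules. -/
lemma gprj_of_coinduction (C : ModuleCat.{u} A → Prop) (hfin : ∀ M, C M → Module.Finite A M)
    (hl : ∀ M, C M → ∃ N, C N ∧ HasSyzygySequence N M)
    (hr : ∀ M, C M → ∃ N, C N ∧ HasSyzygySequence M N) (M : ModuleCat.{u} A) (hM : C M) :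
    gprj A M := by
  choose l hlC hl using hl
  choose r hrC hr using hr
  let L : Subtype C → Subtype C := fun M => ⟨l M.1 M.2, hlC _ _⟩
  let R : Subtype C → Subtype C := fun M => ⟨r M.1 M.2, hrC _ _⟩
  let N : ℤ → Subtype C := fun n => match n with
    | Int.ofNat n => R^[n] ⟨M, hM⟩
    | Int.negSucc n => L^[n + 1] ⟨M, hM⟩
  refine gprj_of_sequence (fun n => (N n).1) (fun n => ?_) (hfin _ hM)
  match n with
  | Int.ofNat n =>
    have : N (Int.ofNat n + 1) = R (N (Int.ofNat n)) := Function.iterate_succ_apply' R n _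
    rw [this]
    exact hr _ _
  | Int.negSucc 0 => exact hl M hM
  | Int.negSucc (n + 1) =>
    have : N (Int.negSucc (n + 1)) = L (N (Int.negSucc (n + 1) + 1)) :=
      Function.iterate_succ_apply' L (n + 1) _
    rw [this]
    exact hl _ _

/-- Finitely generated modules with vanishing `Ext¹(-, A)` that embed into a finitely generated
projective module `Q` such that the cokernel is torsionless with vanishing `Ext¹(-, A)`;
the conditions on the cokernel are stated in terms of linear forms on `Q`. This class contains
the Gorenstein projective modules, and it is visibly closed under extensions and retracts. -/
def CosyzygyEmbeddable (A : Type u) [Ring A] (K : Type u) [AddCommGroup K] [Module A K] : Prop :=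
  Module.Finite A K ∧ ExtVanish A K ∧ ∃ (Q : ModuleCat.{u} A) (j : K →ₗ[A] Q),
    Module.Finite A Q ∧ Module.Projective A Q ∧ Function.Injective j ∧
    (∀ φ : K →ₗ[A] A, ∃ ψ : Q →ₗ[A] A, ∀ x, ψ (j x) = φ x) ∧
    ∀ q : Q, (∀ x, j x ≠ q) → ∃ ψ : Q →ₗ[A] A, (∀ x, ψ (j x) = 0) ∧ ψ q ≠ 0

variable {X Y Z P Q K : Type u} [AddCommGroup X] [Module A X] [AddCommGroup Y] [Module A Y]
  [AddCommGroup Z] [Module A Z] [AddCommGroup P] [Module A P] [AddCommGroup Q] [Module A Q]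
  [AddCommGroup K] [Module A K]

lemma TotallyAcyclicComplex.exists_extension (C : TotallyAcyclicComplex A) (i : ℤ)
    (φ : LinearMap.ker (C.d (i + 1 + 1)) →ₗ[A] A) :
    ∃ ψ : C.X (i + 1 + 1) →ₗ[A] A, ∀ x : LinearMap.ker (C.d (i + 1 + 1)), ψ x = φ x := by
  have hd : ∀ x, C.d (i + 1 + 1) (C.d (i + 1) x) = 0 := fun x => (C.exact (i + 1) _).2 ⟨x, rfl⟩
  have hd' : ∀ x, C.d (i + 1) (C.d i x) = 0 := fun x => (C.exact i _).2 ⟨x, rfl⟩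
  obtain ⟨ψ, hψ⟩ := (C.hom_exact i (φ ∘ₗ (C.d (i + 1)).codRestrict _ hd)).1 (by
    ext x
    have : (C.d (i + 1)).codRestrict (LinearMap.ker (C.d (i + 1 + 1))) hd (C.d i x) = 0 :=
      Subtype.ext (hd' x)
    simp [this])
  refine ⟨ψ, fun x => ?_⟩
  obtain ⟨y, hy⟩ := (C.exact (i + 1) _).1 x.2
  have h1 := LinearMap.congr_fun hψ y
  have h2 : (C.d (i + 1)).codRestrict (LinearMap.ker (C.d (i + 1 + 1))) hd y = x :=
    Subtype.ext hy
  rw [LinearMap.comp_apply, LinearMap.comp_apply, h2, hy] at h1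
  exact h1

lemma gprj.cosyzygyEmbeddable {G : ModuleCat.{u} A} (hG : gprj A G) :
    CosyzygyEmbeddable A G := by
  obtain ⟨hfin, C, n, ⟨e⟩⟩ := hG
  obtain ⟨i, rfl⟩ : ∃ i, n = i + 1 + 1 + 1 := ⟨n - 3, by ring⟩
  have := C.projective
  have := C.finite
  refine ⟨hfin, ExtVanish.of_equiv ?_ e, C.X (i + 1 + 1 + 1), Submodule.subtype _ ∘ₗ e.toLinearMap,
    C.finite _, C.projective _, Subtype.val_injective.comp e.injective, fun φ => ?_,
    fun q hq => ?_⟩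
  · have hd : ∀ x, C.d (i + 1 + 1 + 1) (C.d (i + 1 + 1) x) = 0 :=
      fun x => (C.exact (i + 1 + 1) _).2 ⟨x, rfl⟩
    refine extVanish_of_projective (LinearMap.ker (C.d (i + 1 + 1))).subtype
      ((C.d (i + 1 + 1)).codRestrict (LinearMap.ker (C.d (i + 1 + 1 + 1))) hd) ?_ ?_
      (C.exists_extension i)
    · rintro ⟨y, hy⟩
      obtain ⟨x, rfl⟩ := (C.exact _ _).1 hy
      exact ⟨x, rfl⟩
    · intro x
      rw [Subtype.ext_iff]
      exact ⟨fun hx => ⟨⟨x, hx⟩, rfl⟩, fun ⟨y, hy⟩ => hy ▸ y.2⟩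
  · obtain ⟨ψ, hψ⟩ := C.exists_extension (i + 1) (φ ∘ₗ e.symm.toLinearMap)
    exact ⟨ψ, fun x => by simpa using hψ (e x)⟩
  · have hq' : C.d _ q ≠ 0 := fun h0 => hq (e.symm ⟨q, h0⟩) (by simp)
    obtain ⟨f, hf⟩ := torsionless_projective (A := A) _ hq'
    exact ⟨f ∘ₗ C.d _, fun x => by simp, hf⟩

lemma CosyzygyEmbeddable.torsionless (h : CosyzygyEmbeddable A K) : Torsionless A K := by
  obtain ⟨-, -, Q, j, hQ, hQ', hj, -⟩ := h
  exact torsionless_projective.of_injective j hj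

/-! ### Closure properties -/

lemma CosyzygyEmbeddable.of_retract (h : CosyzygyEmbeddable A Y) (i : X →ₗ[A] Y)
    (r : Y →ₗ[A] X) (hr : ∀ x, r (i x) = x) : CosyzygyEmbeddable A X := by
  have htl := h.torsionless
  obtain ⟨hfin, hext, Q, j, hQ, hQ', hj, h1, h2⟩ := h
  refine ⟨Module.Finite.of_surjective r fun x => ⟨_, hr x⟩, hext.of_retract i r hr, Q, j ∘ₗ i,
    hQ, hQ', hj.comp (Function.LeftInverse.injective hr), fun φ => ?_, fun q hq => ?_⟩
  · obtain ⟨ψ, hψ⟩ := h1 (φ ∘ₗ r)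
    exact ⟨ψ, fun x => by simp [hψ, hr]⟩
  · by_cases hq' : ∃ y, j y = q
    · obtain ⟨y, rfl⟩ := hq'
      obtain ⟨f, hf⟩ := htl (y - i (r y)) fun h0 => hq (r y) (by
        rw [LinearMap.comp_apply, ← sub_eq_zero.1 h0])
      obtain ⟨ψ, hψ⟩ := h1 (f ∘ₗ (LinearMap.id - i ∘ₗ r))
      exact ⟨ψ, fun x => by simp [hψ, hr], by simpa [hψ] using hf⟩
    · push Not at hq'
      obtain ⟨ψ, hψ, hψ'⟩ := h2 q hq'
      exact ⟨ψ, fun x => hψ _, hψ'⟩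

lemma CosyzygyEmbeddable.extension (hX : CosyzygyEmbeddable A X) (hZ : CosyzygyEmbeddable A Z)
    (i : X →ₗ[A] Y) (hi : Function.Injective i) (p : Y →ₗ[A] Z) (hp : Function.Surjective p)
    (he : Function.Exact i p) : CosyzygyEmbeddable A Y := by
  obtain ⟨hXf, hXe, Q, j, hQ, hQ', hj, hj1, hj2⟩ := hX
  obtain ⟨hZf, hZe, R, k, hR, hR', hk, hk1, hk2⟩ := hZ
  obtain ⟨J, hJ⟩ := hZe.extend_proj i hi p hp he j
  have hpi : ∀ x, p (i x) = 0 := fun x => (he _).2 ⟨x, rfl⟩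
  have hfin : Module.Finite A Y := by
    refine ⟨Submodule.fg_of_fg_map_of_fg_inf_ker p ?_ ?_⟩
    · rw [Submodule.map_top, LinearMap.range_eq_top.2 hp]
      exact Module.Finite.fg_top
    · rw [top_inf_eq, LinearMap.exact_iff.1 he, LinearMap.range_eq_map]
      exact Module.Finite.fg_top.map i
  refine ⟨hfin, hXe.extension hZe i hi p hp he, ModuleCat.of A (Q × R),
    J.prod (k ∘ₗ p), inferInstanceAs (Module.Finite A (Q × R)),
    inferInstanceAs (Module.Projective A (Q × R)), ?_, fun φ => ?_, ?_⟩
  · rw [injective_iff_map_eq_zero]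
    intro y hy
    have h1 : J y = 0 := congrArg Prod.fst hy
    have h2 : k (p y) = 0 := congrArg Prod.snd hy
    rw [map_eq_zero_iff _ hk] at h2
    obtain ⟨x, rfl⟩ := (he y).1 h2
    rw [hJ, map_eq_zero_iff _ hj] at h1
    rw [h1, map_zero]
  · obtain ⟨χ, hχ⟩ := hj1 (φ ∘ₗ i)
    obtain ⟨η, hη⟩ := exists_desc p hp (φ - χ ∘ₗ J) (fun y hy => by
      obtain ⟨x, rfl⟩ := (he y).1 hy
      simp [hJ, hχ])
    obtain ⟨ζ, hζ⟩ := hk1 η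
    refine ⟨χ.coprod ζ, fun y => ?_⟩
    change χ (J y) + ζ (k (p y)) = φ y
    simp [hζ, hη]
  · rintro ⟨q, s⟩ hqs
    by_cases hs : ∃ z, k z = s
    · obtain ⟨z, rfl⟩ := hs
      obtain ⟨y, rfl⟩ := hp z
      obtain ⟨χ, hχ, hχ'⟩ := hj2 (q - J y) (fun x hx => hqs (y + i x) (by
        change (J (y + i x), k (p (y + i x))) = _
        rw [map_add, map_add, hJ, hx, hpi, add_zero, add_sub_cancel]))
      obtain ⟨η, hη⟩ := exists_desc p hp (χ ∘ₗ J) (fun y hy => by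
        obtain ⟨x, rfl⟩ := (he y).1 hy
        simp [hJ, hχ])
      obtain ⟨ζ, hζ⟩ := hk1 η
      refine ⟨χ.coprod (-ζ), fun y => ?_, ?_⟩
      · change χ (J y) + -ζ (k (p y)) = 0
        simp [hζ, hη]
      · change χ q + -ζ (k (p y)) ≠ 0
        rw [hζ, hη]
        simpa [sub_eq_add_neg] using hχ'
    · push Not at hs
      obtain ⟨ψ, hψ, hψ'⟩ := hk2 s hs
      exact ⟨ψ ∘ₗ LinearMap.snd A Q R, fun y => hψ (p y), hψ'⟩

/-- If the syzygy of `N` lies in the class and `Ext¹(N, A) = 0`, then `N` is torsionless: maps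
extend in both directions between the projective modules `P` and `Q` containing `ker π`, so that
`N` is a submodule of the direct sum of `P` and the cokernel of `ker π` in `Q`. -/
lemma CosyzygyEmbeddable.torsionless_of_syzygy [Module.Finite A P] [Module.Projective A P]
    (i : K →ₗ[A] P) (hi : Function.Injective i) (p : P →ₗ[A] X) (hp : Function.Surjective p)
    (he : Function.Exact i p) (hK : CosyzygyEmbeddable A K) (hX : ExtVanish A X) :
    Torsionless A X := by
  obtain ⟨-, -, Q, j, hQ, hQ', hj, hj1, hj2⟩ := hK
  obtain ⟨α, hα⟩ := hX.extend_proj i hi p hp he j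
  obtain ⟨n, s, t, hst⟩ := exists_retract_pi (A := A) P
  choose β hβ using fun l : Fin n => hj1 (LinearMap.proj l ∘ₗ s ∘ₗ i)
  have hβ' : ∀ x, LinearMap.pi β (j x) = s (i x) := fun x => by
    ext l
    exact hβ l x
  have key : ∀ f : P →ₗ[A] A, (∀ x, f (i x) = 0) → ∀ y, f y ≠ 0 → ∃ g : X →ₗ[A] A, g (p y) ≠ 0 :=
    fun f hf y hy => by
      obtain ⟨g, hg⟩ := exists_desc p hp f (fun y hy => by
        obtain ⟨x, rfl⟩ := (he y).1 hy
        exact hf x)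
      exact ⟨g, by rwa [hg]⟩
  intro x hx
  obtain ⟨y, rfl⟩ := hp x
  by_cases hy : ∃ k, j k = α y
  · obtain ⟨k, hk⟩ := hy
    obtain ⟨f, hf⟩ := torsionless_projective (A := A) (y - i k) (fun h0 => hx (by
      rw [sub_eq_zero.1 h0]
      exact (he _).2 ⟨k, rfl⟩))
    refine key (f ∘ₗ (LinearMap.id - t ∘ₗ LinearMap.pi β ∘ₗ α)) (fun x => ?_) y ?_
    · have : t (LinearMap.pi β (α (i x))) = i x := by rw [hα, hβ', hst]
      simp [this]
    · have : t (LinearMap.pi β (α y)) = i k := by rw [← hk, hβ', hst]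
      simpa [this] using hf
  · push Not at hy
    obtain ⟨ψ, hψ, hψ'⟩ := hj2 _ hy
    exact key (ψ ∘ₗ α) (fun x => by rw [LinearMap.comp_apply, hα, hψ]) y hψ'

end Gorenstein

/-! ### Retracts of finite direct sums -/

section InAdd

variable {A : Type*} [Ring A]

/-- `X` is a retract of a finite direct sum of copies of `M`, expressed by writing the identity of
`X` as a finite sum of endomorphisms that factor through `M`. -/
def InAdd (A : Type*) [Ring A] (M X : Type*) [AddCommGroup M] [Module A M] [AddCommGroup X]
    [Module A X] : Prop :=
  ∃ (κ : Type) (_ : Fintype κ) (a : κ → X →ₗ[A] M) (b : κ → M →ₗ[A] X),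
    ∀ x, ∑ k, b k (a k x) = x

variable {M N X Y : Type*} [AddCommGroup M] [Module A M] [AddCommGroup N] [Module A N]
  [AddCommGroup X] [Module A X] [AddCommGroup Y] [Module A Y]

lemma InAdd.of_retract (i : X →ₗ[A] M) (r : M →ₗ[A] X) (h : ∀ x, r (i x) = x) : InAdd A M X :=
  ⟨Unit, inferInstance, fun _ => i, fun _ => r, fun x => by simp [h]⟩

lemma InAdd.of_equiv (e : M ≃ₗ[A] N) : InAdd A M N :=
  .of_retract e.symm.toLinearMap e.toLinearMap e.apply_symm_apply

lemma InAdd.trans (h : InAdd A M N) (h' : InAdd A N X) : InAdd A M X := by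
  obtain ⟨κ, _, a, b, hab⟩ := h
  obtain ⟨l, _, c, d, hcd⟩ := h'
  refine ⟨l × κ, inferInstance, fun k => a k.2 ∘ₗ c k.1, fun k => d k.1 ∘ₗ b k.2, fun x => ?_⟩
  rw [Fintype.sum_prod_type]
  simp only [LinearMap.comp_apply, ← map_sum, hab, hcd]

lemma InAdd.prod (h : InAdd A M X) (h' : InAdd A M Y) : InAdd A M (X × Y) := by
  obtain ⟨κ, _, a, b, hab⟩ := h
  obtain ⟨l, _, c, d, hcd⟩ := h'
  refine ⟨κ ⊕ l, inferInstance,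
    Sum.elim (fun k => a k ∘ₗ LinearMap.fst A X Y) (fun k => c k ∘ₗ LinearMap.snd A X Y),
    Sum.elim (fun k => LinearMap.inl A X Y ∘ₗ b k) (fun k => LinearMap.inr A X Y ∘ₗ d k),
    fun x => ?_⟩
  rw [Fintype.sum_sum_type]
  simp only [Sum.elim_inl, Sum.elim_inr, LinearMap.comp_apply, ← map_sum]
  ext <;> simp [hab, hcd]

lemma inAdd_projective (P : Type*) [AddCommGroup P] [Module A P] [Module.Finite A P]
    [Module.Projective A P] : InAdd A A P := by
  obtain ⟨n, i, r, h⟩ := exists_retract_pi (A := A) P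
  refine ⟨Fin n, inferInstance, fun k => LinearMap.proj k ∘ₗ i,
    fun k => r ∘ₗ LinearMap.single A (fun _ => A) k, fun x => ?_⟩
  simp only [LinearMap.comp_apply, ← map_sum, LinearMap.proj_apply, LinearMap.coe_single]
  rw [Finset.univ_sum_single, h]

lemma addClosure_iff {A : Type u} [Ring A] (M X : ModuleCat.{u} A) :
    addClosure M X ↔ InAdd A M X := by
  constructor
  · rintro ⟨n, N, ⟨N', hN⟩, ⟨e⟩⟩
    refine ⟨Fin n, inferInstance, fun k => LinearMap.proj k ∘ₗ N.subtype ∘ₗ e.toLinearMap,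
      fun k => e.symm.toLinearMap ∘ₗ N.projectionOnto N' hN ∘ₗ LinearMap.single A (fun _ => M) k,
      fun x => ?_⟩
    simp only [LinearMap.comp_apply, ← map_sum, LinearMap.proj_apply, LinearMap.coe_single]
    rw [Finset.univ_sum_single, Submodule.subtype_apply, Submodule.projectionOnto_apply_left]
    exact e.symm_apply_apply x
  · rintro ⟨κ, _, a, b, hab⟩
    let σ := Fintype.equivFin κ
    let i : X →ₗ[A] (Fin (Fintype.card κ) → M) := LinearMap.pi fun t => a (σ.symm t)
    let r : (Fin (Fintype.card κ) → M) →ₗ[A] X :=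
      ∑ t, b (σ.symm t) ∘ₗ LinearMap.proj t
    have hr : ∀ x, r (i x) = x := fun x => by
      simp only [r, i, LinearMap.sum_apply, LinearMap.comp_apply, LinearMap.proj_apply,
        LinearMap.pi_apply]
      rw [σ.symm.sum_comp (fun k => b k (a k x)), hab]
    refine ⟨_, LinearMap.range i, ⟨_, LinearMap.isCompl_of_proj (f := i.rangeRestrict ∘ₗ r) ?_⟩,
      ⟨LinearEquiv.ofInjective i (Function.LeftInverse.injective hr)⟩⟩
    rintro ⟨_, x, rfl⟩
    exact Subtype.ext (congrArg i (hr x))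

/-! ### The radical as a functor -/

/-- The map induced on Jacobson radicals. -/
def radMap (f : X →ₗ[A] Y) : Module.jacobson A X →ₗ[A] Module.jacobson A Y :=
  f.restrict (fun _ hx => Module.le_comap_jacobson f hx)

@[simp] lemma coe_radMap (f : X →ₗ[A] Y) (x : Module.jacobson A X) : (radMap f x : Y) = f x :=
  rfl

lemma InAdd.jacobson (h : InAdd A M X) : InAdd A (Module.jacobson A M) (Module.jacobson A X) := by
  obtain ⟨κ, _, a, b, hab⟩ := h
  refine ⟨κ, inferInstance, fun k => radMap (a k), fun k => radMap (b k), fun x => ?_⟩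
  apply Subtype.ext
  simpa using hab x

lemma InAdd.jacobson_prod_self (h : InAdd A M X) :
    InAdd A (Module.jacobson A M × M) (Module.jacobson A X × X) :=
  InAdd.prod
    (InAdd.trans (.of_retract (LinearMap.inl A _ _) (LinearMap.fst A _ _) fun _ => rfl) h.jacobson)
    (InAdd.trans (.of_retract (LinearMap.inr A _ _) (LinearMap.snd A _ _) fun _ => rfl) h)

lemma eq_top_of_sup_jacobson [Module.Finite A X] (L : Submodule A X)
    (h : L ⊔ Module.jacobson A X = ⊤) : L = ⊤ := by
  by_contra hL
  obtain ⟨M, hM, hLM⟩ := (eq_top_or_exists_le_coatom L).resolve_left hL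
  exact hM.1 (top_le_iff.1 (h ▸ sup_le hLM (sInf_le hM)))

/-- Nakayama's lemma for maps that are surjective modulo the radical. -/
lemma surjective_of_sub_mem_jacobson [Module.Finite A Y] (f : X →ₗ[A] Y)
    (h : ∀ y, ∃ x, y - f x ∈ Module.jacobson A Y) : Function.Surjective f := by
  rw [← LinearMap.range_eq_top]
  apply eq_top_of_sup_jacobson
  rw [eq_top_iff]
  intro y _
  obtain ⟨x, hx⟩ := h y
  exact Submodule.mem_sup.2 ⟨f x, ⟨x, rfl⟩, _, hx, add_sub_cancel _ _⟩

/-! ### Modules with local endomorphism ring -/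

/-- The endomorphism ring of `M` is local or zero: of two endomorphisms with sum `1`, one is
invertible. -/
def LocalEnd (A : Type*) [Ring A] (M : Type*) [AddCommGroup M] [Module A M] : Prop :=
  ∀ f : Module.End A M, IsUnit f ∨ IsUnit (1 - f)

/-- Fitting's lemma. -/
lemma localEnd_or_isCompl [IsArtinian A M] [IsNoetherian A M] :
    LocalEnd A M ∨ ∃ E F : Submodule A M, IsCompl E F ∧ E ≠ ⊤ ∧ F ≠ ⊤ := by
  by_contra! h
  obtain ⟨h1, h2⟩ := h
  apply h1
  intro f
  obtain ⟨n, hn1, hn⟩ := ((Filter.eventually_ge_atTop 1).and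
    f.eventually_isCompl_ker_pow_range_pow).exists
  by_cases hk : LinearMap.ker (f ^ n) = ⊤
  · right
    exact IsNilpotent.isUnit_one_sub ⟨n, LinearMap.ker_eq_top.1 hk⟩
  · left
    have hr := h2 _ _ hn hk
    have hi : LinearMap.ker (f ^ n) = ⊥ := by
      have := hn.inf_eq_bot
      rwa [hr, inf_top_eq] at this
    have hu : IsUnit (f ^ n) :=
      (Module.End.isUnit_iff _).2 ⟨LinearMap.ker_eq_bot.1 hi, LinearMap.range_eq_top.1 hr⟩
    exact (isUnit_pow_iff (Nat.one_le_iff_ne_zero.1 hn1)).1 hu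

lemma LocalEnd.isUnit_of_add (h : LocalEnd A M) {f g : Module.End A M} (hu : IsUnit (f + g)) :
    IsUnit f ∨ IsUnit g := by
  obtain ⟨u, hu⟩ := hu
  have h1 : (↑u⁻¹ : Module.End A M) * g = 1 - ↑u⁻¹ * f := by
    rw [eq_sub_iff_add_eq', ← mul_add, ← hu, Units.inv_mul]
  rcases h (↑u⁻¹ * f) with h2 | h2
  · left
    exact (Units.isUnit_units_mul _ _).1 h2
  · right
    rw [← h1] at h2
    exact (Units.isUnit_units_mul _ _).1 h2

lemma LocalEnd.exists_isUnit_of_sum [Nontrivial M] (h : LocalEnd A M) {κ : Type*}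
    (s : Finset κ) (f : κ → Module.End A M) (hf : IsUnit (∑ k ∈ s, f k)) :
    ∃ k ∈ s, IsUnit (f k) := by
  classical
  induction s using Finset.induction_on with
  | empty => simp at hf
  | insert a s ha ih =>
    rw [Finset.sum_insert ha] at hf
    rcases h.isUnit_of_add hf with h1 | h1
    · exact ⟨a, Finset.mem_insert_self _ _, h1⟩
    · obtain ⟨k, hk, hk'⟩ := ih h1
      exact ⟨k, Finset.mem_insert_of_mem hk, hk'⟩

/-- `X` is a retract of `M`, that is, isomorphic to a direct summand. -/
def IsRetract (A : Type*) [Ring A] (M X : Type*) [AddCommGroup M] [Module A M] [AddCommGroup X]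
    [Module A X] : Prop :=
  ∃ (i : X →ₗ[A] M) (r : M →ₗ[A] X), ∀ x, r (i x) = x

lemma isRetract_of_isUnit (i : X →ₗ[A] M) (r : M →ₗ[A] X) (h : IsUnit (r ∘ₗ i : Module.End A X)) :
    IsRetract A M X := by
  obtain ⟨u, hu⟩ := h
  refine ⟨i, (↑u⁻¹ : Module.End A X) ∘ₗ r, fun x => ?_⟩
  have : (↑u⁻¹ : Module.End A X) * (r ∘ₗ i : Module.End A X) = 1 := by rw [← hu, Units.inv_mul]
  exact LinearMap.congr_fun this x

lemma LocalEnd.isRetract_of_inAdd [Nontrivial X] (h : LocalEnd A X) (hX : InAdd A M X) :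
    IsRetract A M X := by
  obtain ⟨κ, _, a, b, hab⟩ := hX
  obtain ⟨k, -, hk⟩ := h.exists_isUnit_of_sum Finset.univ
    (fun k => (b k ∘ₗ a k : Module.End A X)) (by
      have : ∑ k, (b k ∘ₗ a k : Module.End A X) = 1 := LinearMap.ext fun x => by
        simpa using hab x
      rw [this]
      exact isUnit_one)
  exact isRetract_of_isUnit _ _ hk

/-- A module with local endomorphism ring which is a retract of `M × N` is a retract of one of
the factors. -/
lemma LocalEnd.isRetract_prod (h : LocalEnd A X) (hX : IsRetract A (M × N) X) :
    IsRetract A M X ∨ IsRetract A N X := by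
  obtain ⟨i, r, hr⟩ := hX
  have h1 : ((r ∘ₗ LinearMap.inl A M N) ∘ₗ LinearMap.fst A M N ∘ₗ i : Module.End A X) +
      ((r ∘ₗ LinearMap.inr A M N) ∘ₗ LinearMap.snd A M N ∘ₗ i : Module.End A X) = 1 := by
    ext x
    simp only [LinearMap.add_apply, LinearMap.comp_apply, ← map_add]
    simp [hr]
  rcases h.isUnit_of_add (h1 ▸ isUnit_one) with hu | hu
  · exact Or.inl (isRetract_of_isUnit _ _ hu)
  · exact Or.inr (isRetract_of_isUnit _ _ hu)

end InAdd

/-! ### Minimal projective covers -/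

section Cover

variable {A : Type u} [Ring A]

lemma projective_of_retract {P Q : Type*} [AddCommGroup P] [Module A P] [AddCommGroup Q]
    [Module A Q] [Module.Projective A P] (i : Q →ₗ[A] P) (r : P →ₗ[A] Q)
    (h : ∀ x, r (i x) = x) : Module.Projective A Q :=
  Module.Projective.of_split i r (LinearMap.ext h)

/-- A surjection `p` from a finitely generated projective module `P` restricts to a projective
cover on a direct summand of `P`. A summand of minimal length onto which `p` can be restricted
does it: otherwise some endomorphism of the summand over `X` is not surjective, and its Fitting
decomposition gives a smaller summand. -/
lemma exists_projectiveCover [IsArtinianRing A] {P X : Type u} [AddCommGroup P] [Module A P]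
    [AddCommGroup X] [Module A X] [Module.Finite A P] [Module.Projective A P] (p : P →ₗ[A] X)
    (hp : Function.Surjective p) :
    ∃ (Q : ModuleCat.{u} A) (i : Q →ₗ[A] P) (r : P →ₗ[A] Q), Module.Finite A Q ∧
      Module.Projective A Q ∧ (∀ x, r (i x) = x) ∧ (∀ y, p (i (r y)) = p y) ∧
      ∀ x, p (i x) = 0 → x ∈ Module.jacobson A Q := by
  induction hl : Module.length A P using WellFoundedLT.induction generalizing P with
  | ind l ih =>
  subst hl
  by_cases H : ∀ f : P →ₗ[A] P, (∀ y, p (f y) = p y) → Function.Surjective f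
  · refine ⟨ModuleCat.of A P, LinearMap.id, LinearMap.id, inferInstanceAs (Module.Finite A P),
      inferInstanceAs (Module.Projective A P), fun _ => rfl, fun _ => rfl, fun x hx => ?_⟩
    refine Submodule.mem_sInf.2 fun L hL => ?_
    by_contra hxL
    have hsup : L ⊔ LinearMap.ker p = ⊤ := hL.2 _ (lt_of_le_of_ne le_sup_left fun h => hxL (by
      rw [h]
      exact Submodule.mem_sup_right hx))
    have hs : Function.Surjective (p ∘ₗ L.subtype) := fun z => by
      obtain ⟨y, rfl⟩ := hp z
      obtain ⟨a, ha, b, hb, rfl⟩ := Submodule.mem_sup.1 (hsup ▸ Submodule.mem_top : y ∈ _)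
      exact ⟨⟨a, ha⟩, by simp [LinearMap.mem_ker.1 hb]⟩
    obtain ⟨g, hg⟩ := exists_lift _ hs p
    have h1 := H (L.subtype ∘ₗ g) hg
    exact hL.1 (eq_top_iff.2 fun y _ => by
      obtain ⟨z, rfl⟩ := h1 y
      exact (g z).2)
  · push Not at H
    obtain ⟨f, hf, hfs⟩ := H
    obtain ⟨n, hn1, hn⟩ := ((Filter.eventually_ge_atTop 1).and
      (LinearMap.eventually_isCompl_ker_pow_range_pow f)).exists
    have hfn : ∀ m y, p ((f ^ m) y) = p y := fun m => by
      induction m with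
      | zero => exact fun _ => rfl
      | succ m ih => exact fun y => by rw [pow_succ', Module.End.mul_apply, hf, ih]
    let E := LinearMap.range (f ^ n)
    have hE : E ≠ ⊤ := fun h => hfs fun y => by
      obtain ⟨z, hz⟩ := LinearMap.range_eq_top.1 h y
      obtain ⟨m, rfl⟩ := Nat.exists_eq_succ_of_ne_zero (Nat.one_le_iff_ne_zero.1 hn1)
      exact ⟨(f ^ m) z, by rw [← hz, pow_succ']; rfl⟩
    let s := E.projectionOnto _ hn.symm
    have hs : ∀ y, p (s y) = p y := fun y => by
      rw [← hfn n (s y), ← hfn n y, ← sub_eq_zero, ← map_sub, ← map_sub]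
      have : s (s y - y) = 0 := by
        rw [map_sub, Submodule.projectionOnto_apply_left, sub_self]
      rw [LinearMap.mem_ker.1 ((Submodule.projectionOnto_apply_eq_zero_iff _).1 this), map_zero]
    have hproj : Module.Projective A E := projective_of_retract E.subtype s
      (Submodule.projectionOnto_apply_left _)
    obtain ⟨Q, i, r, hQ, hQ', hri, hir, hrad⟩ := ih _ (Submodule.length_lt hE)
      (P := E) (p ∘ₗ E.subtype) (fun x => by
        obtain ⟨y, rfl⟩ := hp x
        exact ⟨s y, hs y⟩) rfl
    refine ⟨Q, E.subtype ∘ₗ i, r ∘ₗ s, hQ, hQ', fun x => ?_, fun y => ?_, hrad⟩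
    · rw [LinearMap.comp_apply, LinearMap.comp_apply, Submodule.subtype_apply,
        Submodule.projectionOnto_apply_left, hri]
    · exact (hir (s y)).trans (hs y)

/-- Every finitely generated module has a projective cover. -/
lemma exists_cover_of_finite [IsArtinianRing A] (X : Type u) [AddCommGroup X] [Module A X]
    [Module.Finite A X] :
    ∃ (Q : ModuleCat.{u} A) (p : Q →ₗ[A] X), Module.Finite A Q ∧ Module.Projective A Q ∧
      Function.Surjective p ∧ ∀ x, p x = 0 → x ∈ Module.jacobson A Q := by
  obtain ⟨n, p, hp⟩ := Module.Finite.exists_fin' A X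
  obtain ⟨Q, i, r, hQ, hQ', -, hir, hrad⟩ := exists_projectiveCover p hp
  exact ⟨Q, p ∘ₗ i, hQ, hQ', fun x => by
    obtain ⟨y, rfl⟩ := hp x
    exact ⟨r y, hir y⟩, hrad⟩

/-- A projective module with local endomorphism ring has a unique maximal submodule. -/
lemma LocalEnd.isSimpleModule_quotient {P : Type u} [AddCommGroup P] [Module A P]
    [Module.Finite A P] [Module.Projective A P] [Nontrivial P] (h : LocalEnd A P) :
    IsSimpleModule A (P ⧸ Module.jacobson A P) := by
  obtain ⟨M, hM, -⟩ := (eq_top_or_exists_le_coatom (⊥ : Submodule A P)).resolve_left bot_ne_top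
  have huniq : ∀ L : Submodule A P, IsCoatom L → M ≤ L := fun L hL => by
    by_contra hne
    have hsup : L ⊔ M = ⊤ := hL.2 _ (lt_of_le_of_ne le_sup_left fun h => hne (by
      rw [h]
      exact le_sup_right))
    have hs : Function.Surjective (M.mkQ ∘ₗ L.subtype) := fun z => by
      obtain ⟨y, rfl⟩ := M.mkQ_surjective z
      obtain ⟨a, ha, b, hb, rfl⟩ := Submodule.mem_sup.1 (hsup ▸ Submodule.mem_top : y ∈ _)
      exact ⟨⟨a, ha⟩, by simpa using hb⟩
    obtain ⟨g, hg⟩ := exists_lift _ hs M.mkQ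
    rcases h (L.subtype ∘ₗ g) with hu | hu
    · refine hL.1 (eq_top_iff.2 fun y _ => ?_)
      obtain ⟨z, rfl⟩ := ((Module.End.isUnit_iff _).1 hu).2 y
      exact (g z).2
    · refine hM.1 (eq_top_iff.2 fun y _ => ?_)
      obtain ⟨z, rfl⟩ := ((Module.End.isUnit_iff _).1 hu).2 y
      have := hg z
      rw [← Submodule.ker_mkQ M, LinearMap.mem_ker, LinearMap.sub_apply, map_sub]
      change M.mkQ z - (M.mkQ ∘ₗ L.subtype) (g z) = 0
      rw [this, sub_self]
  have : Module.jacobson A P = M := le_antisymm (sInf_le hM) (le_sInf huniq)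
  rw [this]
  exact isSimpleModule_iff_isCoatom.2 hM

/-- A module with local endomorphism ring that is a summand of the radical of a projective module
is a summand of the radical of a projective module with simple top. -/
lemma LocalEnd.exists_simple_top [IsArtinianRing A] {N P : Type u} [AddCommGroup N] [Module A N]
    [AddCommGroup P] [Module A P] [Module.Finite A P] [Module.Projective A P] [Nontrivial N]
    (h : LocalEnd A N)
    (hP : IsRetract A (Module.jacobson A P) N) :
    ∃ Q : ModuleCat.{u} A, Module.Finite A Q ∧ Module.Projective A Q ∧
      IsSimpleModule A (Q ⧸ Module.jacobson A Q) ∧ IsRetract A (Module.jacobson A Q) N := by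
  induction hl : Module.length A P using WellFoundedLT.induction generalizing P with
  | ind l ih =>
  subst hl
  have hnt : Nontrivial P := by
    obtain ⟨i, r, hr⟩ := hP
    obtain ⟨x, hx⟩ := exists_ne (0 : N)
    refine ⟨i x, 0, fun h0 => hx ?_⟩
    rw [← hr x, show i x = 0 from Subtype.ext h0, map_zero]
  rcases localEnd_or_isCompl (A := A) (M := P) with hloc | ⟨E, F, hEF, hE, hF⟩
  · exact ⟨ModuleCat.of A P, inferInstanceAs (Module.Finite A P),
      inferInstanceAs (Module.Projective A P), hloc.isSimpleModule_quotient, hP⟩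
  · have hPE : Module.Projective A E := projective_of_retract E.subtype
      (E.projectionOnto F hEF) (Submodule.projectionOnto_apply_left _)
    have hPF : Module.Projective A F := projective_of_retract F.subtype
      (F.projectionOnto E hEF.symm) (Submodule.projectionOnto_apply_left _)
    obtain ⟨i, r, hr⟩ := hP
    have h1 : IsRetract A (Module.jacobson A E × Module.jacobson A F) N := by
      refine ⟨((radMap (E.projectionOnto F hEF)).prod
        (radMap (F.projectionOnto E hEF.symm))) ∘ₗ i,
        r ∘ₗ (radMap E.subtype).coprod (radMap F.subtype), fun x => ?_⟩
      have : (radMap E.subtype).coprod (radMap F.subtype)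
          (((radMap (E.projectionOnto F hEF)).prod
            (radMap (F.projectionOnto E hEF.symm))) (i x)) = i x := by
        apply Subtype.ext
        exact Submodule.projection_add_projection_eq_self hEF (i x : P)
      rw [LinearMap.comp_apply, LinearMap.comp_apply, this, hr]
    rcases h.isRetract_prod h1 with h2 | h2
    · exact ih _ (Submodule.length_lt hE) h2 rfl
    · exact ih _ (Submodule.length_lt hF) h2 rfl

end Cover

/-! ### Torsionless modules over one-Gorenstein rings -/

section OneGorenstein

/-- For finitely generated modules, being torsionless is equivalent to the vanishing of
`Ext¹(-, A)`. For artinian rings that are noetherian on both sides this characterises the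
`1`-Gorenstein rings, and it only refers to modules on one side. -/
def TorsionlessIffExtVanish (A : Type u) [Ring A] : Prop :=
  ∀ (M : Type u) [AddCommGroup M] [Module A M] [Module.Finite A M],
    Torsionless A M ↔ ExtVanish A M

variable {A : Type u} [Ring A]

/-- A finitely generated module has a left approximation by free modules of finite rank. -/
lemma exists_left_approximation [IsNoetherian Aᵐᵒᵖ A] (M : Type u) [AddCommGroup M] [Module A M]
    [Module.Finite A M] : ∃ (n : ℕ) (j : M →ₗ[A] (Fin n → A)),
      ∀ φ : M →ₗ[A] A, ∃ ψ : (Fin n → A) →ₗ[A] A, ∀ x, ψ (j x) = φ x := by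
  obtain ⟨m, s, hs⟩ := Module.Finite.exists_fin (R := A) (M := M)
  let ev : (M →ₗ[A] A) →ₗ[Aᵐᵒᵖ] (Fin m → A) :=
    { toFun := fun f i => f (s i)
      map_add' := fun _ _ => rfl
      map_smul' := fun _ _ => rfl }
  have hev : Function.Injective ev := fun f g hfg => by
    refine LinearMap.ext_on_range hs fun i => congrFun hfg i
  have hnoeth : IsNoetherian Aᵐᵒᵖ (M →ₗ[A] A) := isNoetherian_of_injective ev hev
  obtain ⟨n, f, hf⟩ := Module.Finite.exists_fin (R := Aᵐᵒᵖ) (M := M →ₗ[A] A)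
  refine ⟨n, LinearMap.pi f, fun φ => ?_⟩
  have hφ : φ ∈ Submodule.span Aᵐᵒᵖ (Set.range f) := hf ▸ Submodule.mem_top
  obtain ⟨c, hc⟩ := (Submodule.mem_span_range_iff_exists_fun _).1 hφ
  refine ⟨Fintype.linearCombination A (fun i => (c i).unop), fun x => ?_⟩
  rw [← hc, Fintype.linearCombination_apply]
  simp [LinearMap.sum_apply]

lemma injective_of_left_approximation {M P : Type u} [AddCommGroup M] [Module A M]
    [AddCommGroup P] [Module A P] (j : M →ₗ[A] P) (hM : Torsionless A M)
    (hj : ∀ φ : M →ₗ[A] A, ∃ ψ : P →ₗ[A] A, ∀ x, ψ (j x) = φ x) : Function.Injective j := by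
  rw [injective_iff_map_eq_zero]
  intro x hx
  by_contra hne
  obtain ⟨φ, hφ⟩ := hM x hne
  obtain ⟨ψ, hψ⟩ := hj φ
  exact hφ (by rw [← hψ, hx, map_zero])

/-- Over a `1`-Gorenstein ring the Gorenstein projective modules are the torsionless ones. -/
lemma TorsionlessIffExtVanish.gprj_iff [IsNoetherianRing A] [IsNoetherian Aᵐᵒᵖ A]
    (h : TorsionlessIffExtVanish A) (G : ModuleCat.{u} A) :
    gprj A G ↔ Module.Finite A G ∧ Torsionless A G := by
  refine ⟨fun hG => ⟨hG.1, hG.cosyzygyEmbeddable.torsionless⟩, ?_⟩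
  refine gprj_of_coinduction (fun M => Module.Finite A M ∧ Torsionless A M) (fun _ hM => hM.1)
    ?_ ?_ G
  · rintro M ⟨hM, hM'⟩
    obtain ⟨n, p, hp⟩ := Module.Finite.exists_fin' A M
    refine ⟨ModuleCat.of A (LinearMap.ker p),
      ⟨inferInstanceAs (Module.Finite A (LinearMap.ker p)),
        (torsionless_projective (P := Fin n → A)).of_injective (LinearMap.ker p).subtype
          Subtype.val_injective⟩,
      ModuleCat.of A (Fin n → A), (LinearMap.ker p).subtype, p,
      inferInstanceAs (Module.Finite A (Fin n → A)),
      inferInstanceAs (Module.Projective A (Fin n → A)), Subtype.val_injective, hp,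
      LinearMap.exact_subtype_ker_map p, ?_⟩
    exact ((h M).1 hM').extend _ Subtype.val_injective p hp (LinearMap.exact_subtype_ker_map p)
  · rintro M ⟨hM, hM'⟩
    obtain ⟨n, j, hj⟩ := exists_left_approximation (A := A) M
    have hji := injective_of_left_approximation j hM' hj
    refine ⟨ModuleCat.of A ((Fin n → A) ⧸ LinearMap.range j),
      ⟨inferInstanceAs (Module.Finite A ((Fin n → A) ⧸ LinearMap.range j)), ?_⟩,
      ModuleCat.of A (Fin n → A), j, (LinearMap.range j).mkQ,
      inferInstanceAs (Module.Finite A (Fin n → A)),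
      inferInstanceAs (Module.Projective A (Fin n → A)), hji, Submodule.mkQ_surjective _,
      LinearMap.exact_map_mkQ_range j, hj⟩
    exact (h ((Fin n → A) ⧸ LinearMap.range j)).2 (extVanish_of_projective j
      (LinearMap.range j).mkQ (Submodule.mkQ_surjective _) (LinearMap.exact_map_mkQ_range j) hj)

/-- The ring `Λ` is `1`-Gorenstein if and only if, for finitely generated right modules, being
torsionless is equivalent to the vanishing of `Ext¹(-, Λ)`. -/
lemma isIwanagaGorenstein_one_iff (Λ : Type u) [Ring Λ] [IsNoetherianRing Λ]
    [IsNoetherianRing Λᵐᵒᵖ] [IsNoetherian Λᵐᵒᵖᵐᵒᵖ Λᵐᵒᵖ] :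
    IsIwanagaGorenstein Λ 1 ↔ TorsionlessIffExtVanish Λᵐᵒᵖ := by
  let e : ModuleCat.of Λᵐᵒᵖ Λ ≅ ModuleCat.of Λᵐᵒᵖ Λᵐᵒᵖ := LinearEquiv.toModuleIso
    { MulOpposite.opAddEquiv with
      map_smul' := fun _ _ => rfl }
  constructor
  · rintro ⟨h1, h2⟩ M _ _ _
    constructor
    · intro hM
      have h3 : HasInjectiveDimensionLE (ModuleCat.of Λᵐᵒᵖ Λᵐᵒᵖ) 1 :=
        hasInjectiveDimensionLT_of_iso e 2
      obtain ⟨n, j, hj⟩ := exists_left_approximation (A := Λᵐᵒᵖ) M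
      exact extVanish_of_hasInjectiveDimensionLE h3 j (injective_of_left_approximation j hM hj)
    · exact torsionless_of_extVanish
        (fun c L => extVanish_of_hasInjectiveDimensionLE h1 L.subtype Subtype.val_injective) M
  · intro h
    constructor
    · exact hasInjectiveDimensionLE_one_iff.2
        (extVanish_ideal_of_torsionless fun N _ _ _ => (h N).2)
    · have h3 : HasInjectiveDimensionLE (ModuleCat.of Λᵐᵒᵖ Λᵐᵒᵖ) 1 :=
        hasInjectiveDimensionLE_one_iff.2 fun L => (h L).1
          (torsionless_projective.of_injective L.subtype Subtype.val_injective)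
      exact hasInjectiveDimensionLT_of_iso e.symm 2

/-- If `K` is a submodule of `L` with simple quotient `S`, then `K` is a retract of the pullback
of `L` and the projective cover of `S`, which is an extension of `L` by the radical of a
projective module. -/
lemma CosyzygyEmbeddable.of_simple_quotient [IsArtinianRing A]
    (hrad : ∀ (P : ModuleCat.{u} A), Module.Finite A P → Module.Projective A P →
      CosyzygyEmbeddable A (Module.jacobson A P)) {L S : Type u} [AddCommGroup L] [Module A L]
    [AddCommGroup S] [Module A S] [IsSimpleModule A S] (hL : CosyzygyEmbeddable A L)
    (s : L →ₗ[A] S) (hs : Function.Surjective s) : CosyzygyEmbeddable A (LinearMap.ker s) := by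
  have hLf : Module.Finite A L := hL.1
  obtain ⟨P, p, hP, hP', hp, hker⟩ := exists_cover_of_finite (A := A) S
  have hle : ∀ x ∈ Module.jacobson A P, p x = 0 := fun x hx => by
    have hle : Module.jacobson A P ≤ LinearMap.ker p := by
      apply IsSemisimpleModule.jacobson_le_ker
    exact hle hx
  let W := LinearMap.ker (s.coprod (-p))
  have hW : ∀ w : W, s w.1.1 = p w.1.2 := fun w => by
    have := w.2
    simp only [W, LinearMap.mem_ker, LinearMap.coprod_apply, LinearMap.neg_apply] at this
    exact add_neg_eq_zero.1 this
  have hWext : CosyzygyEmbeddable A W := by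
    refine (hrad P hP hP').extension hL ((LinearMap.inr A L P ∘ₗ
      (Module.jacobson A P).subtype).codRestrict W (fun x => by simp [W, hle])) (fun x y hxy =>
      Subtype.ext (congrArg (fun w : W => w.1.2) hxy)) (LinearMap.fst A L P ∘ₗ W.subtype)
      (fun x => by
        obtain ⟨y, hy⟩ := hp (s x)
        exact ⟨⟨(x, y), by simp [W, hy]⟩, rfl⟩) (fun w => ⟨fun hw => ?_, ?_⟩)
    · have hw : w.1.1 = 0 := hw
      refine ⟨⟨w.1.2, hker _ ?_⟩, Subtype.ext (Prod.ext hw.symm rfl)⟩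
      rw [← hW, hw, map_zero]
    · rintro ⟨x, rfl⟩
      rfl
  obtain ⟨g, hg⟩ := exists_lift s hs p
  refine hWext.of_retract ((LinearMap.inl A L P ∘ₗ (LinearMap.ker s).subtype).codRestrict W
    (fun x => by simp [W])) ((LinearMap.fst A L P ∘ₗ W.subtype -
      g ∘ₗ LinearMap.snd A L P ∘ₗ W.subtype).codRestrict _ (fun w => ?_)) (fun x => ?_)
  · simp [hg, hW]
  · apply Subtype.ext
    change (x : L) - g 0 = x
    rw [map_zero, sub_zero]

/-- If the radicals of projective modules admit cosyzygies, then so do all submodules of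
projective modules, and the ring is `1`-Gorenstein. -/
lemma torsionlessIffExtVanish_of_jacobson [IsArtinianRing A] [IsNoetherian Aᵐᵒᵖ A]
    (hA : ∀ P : ModuleCat.{u} A, Module.Finite A P → Module.Projective A P →
      CosyzygyEmbeddable A P)
    (hrad : ∀ P : ModuleCat.{u} A, Module.Finite A P → Module.Projective A P →
      CosyzygyEmbeddable A (Module.jacobson A P)) : TorsionlessIffExtVanish A := by
  have key : ∀ (n : ℕ) (L : Submodule A (Fin n → A)), CosyzygyEmbeddable A L := fun n L => by
    induction L using IsNoetherian.induction with
    | hgt L ih =>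
    by_cases hL : L = ⊤
    · subst hL
      exact (hA (ModuleCat.of A (Fin n → A)) (inferInstanceAs (Module.Finite A (Fin n → A)))
        (inferInstanceAs (Module.Projective A (Fin n → A)))).of_retract
        (Submodule.topEquiv (R := A) (M := Fin n → A)).toLinearMap
        (Submodule.topEquiv (R := A) (M := Fin n → A)).symm.toLinearMap (fun x => rfl)
    · obtain ⟨M, hM⟩ := exists_covBy_of_wellFoundedLT (not_isMax_iff_ne_top.2 hL)
      have hsimple : IsSimpleModule A (M ⧸ L.submoduleOf M) :=
        (covBy_iff_quot_is_simple hM.le).1 hM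
      have h1 := (ih M hM.lt).of_simple_quotient hrad (L.submoduleOf M).mkQ
        (Submodule.mkQ_surjective _)
      rw [Submodule.ker_mkQ] at h1
      exact h1.of_retract (Submodule.submoduleOfEquivOfLe hM.le).symm.toLinearMap
        (Submodule.submoduleOfEquivOfLe hM.le).toLinearMap (fun x => by simp)
  intro M _ _ _
  constructor
  · intro hM
    obtain ⟨n, j, hj⟩ := exists_left_approximation (A := A) M
    exact (key n (LinearMap.range j)).2.1.of_equiv
      (LinearEquiv.ofInjective j (injective_of_left_approximation j hM hj))
  · intro hM
    obtain ⟨n, p, hp⟩ := Module.Finite.exists_fin' A M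
    exact (key n (LinearMap.ker p)).torsionless_of_syzygy (LinearMap.ker p).subtype
      Subtype.val_injective p hp (LinearMap.exact_subtype_ker_map p) hM

end OneGorenstein

/-! ### Regular maps in the stable category -/

section Regular

variable {A : Type u} [Ring A]

/-- A map that factors through a finitely generated projective module. -/
def StablyZero {X Y : Type u} [AddCommGroup X] [Module A X] [AddCommGroup Y] [Module A Y]
    (f : X →ₗ[A] Y) : Prop :=
  ∃ (P : ModuleCat.{u} A) (a : X →ₗ[A] P) (b : P →ₗ[A] Y), Module.Finite A P ∧
    Module.Projective A P ∧ f = b ∘ₗ a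

/-- A map that is von Neumann regular in the stable category. -/
def StablyRegular {X Y : Type u} [AddCommGroup X] [Module A X] [AddCommGroup Y] [Module A Y]
    (f : X →ₗ[A] Y) : Prop :=
  ∃ s : Y →ₗ[A] X, StablyZero (f - f ∘ₗ s ∘ₗ f)

variable {X Y Z P Q M N : Type u} [AddCommGroup X] [Module A X] [AddCommGroup Y] [Module A Y]
  [AddCommGroup Z] [Module A Z] [AddCommGroup P] [Module A P] [AddCommGroup Q] [Module A Q]
  [AddCommGroup M] [Module A M] [AddCommGroup N] [Module A N]

lemma StablyZero.comp_left {f : X →ₗ[A] Y} (h : StablyZero f) (g : Y →ₗ[A] Z) :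
    StablyZero (g ∘ₗ f) := by
  obtain ⟨P, a, b, hP, hP', rfl⟩ := h
  exact ⟨P, a, g ∘ₗ b, hP, hP', rfl⟩

lemma StablyZero.comp_right {f : Y →ₗ[A] Z} (h : StablyZero f) (g : X →ₗ[A] Y) :
    StablyZero (f ∘ₗ g) := by
  obtain ⟨P, a, b, hP, hP', rfl⟩ := h
  exact ⟨P, a ∘ₗ g, b, hP, hP', rfl⟩

lemma StablyZero.neg {f : X →ₗ[A] Y} (h : StablyZero f) : StablyZero (-f) := by
  obtain ⟨P, a, b, hP, hP', rfl⟩ := h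
  exact ⟨P, a, -b, hP, hP', rfl⟩

lemma StablyZero.add {f g : X →ₗ[A] Y} (hf : StablyZero f) (hg : StablyZero g) :
    StablyZero (f + g) := by
  obtain ⟨P, a, b, hP, hP', rfl⟩ := hf
  obtain ⟨Q, c, e, hQ, hQ', rfl⟩ := hg
  exact ⟨ModuleCat.of A (P × Q), a.prod c, b.coprod e, inferInstanceAs (Module.Finite A (P × Q)),
    inferInstanceAs (Module.Projective A (P × Q)), by ext x; simp⟩

lemma StablyZero.sub {f g : X →ₗ[A] Y} (hf : StablyZero f) (hg : StablyZero g) :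
    StablyZero (f - g) := sub_eq_add_neg f g ▸ hf.add hg.neg

lemma stablyZero_of_projective_left [Module.Finite A X] [Module.Projective A X] (f : X →ₗ[A] Y) :
    StablyZero f :=
  ⟨ModuleCat.of A X, LinearMap.id, f, inferInstanceAs (Module.Finite A X),
    inferInstanceAs (Module.Projective A X), rfl⟩

lemma stablyZero_of_projective_right [Module.Finite A Y] [Module.Projective A Y]
    (f : X →ₗ[A] Y) : StablyZero f :=
  ⟨ModuleCat.of A Y, f, LinearMap.id, inferInstanceAs (Module.Finite A Y),
    inferInstanceAs (Module.Projective A Y), rfl⟩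

lemma StablyZero.stablyRegular {f : X →ₗ[A] Y} (h : StablyZero f) : StablyRegular f :=
  ⟨0, by simpa using h⟩

/-- Regularity of all maps `X → Y` follows from regularity on the summands of `X`. -/
lemma stablyRegular_of_isCompl_left {E F : Submodule A X} (h : IsCompl E F)
    (hE : ∀ f : E →ₗ[A] Y, StablyRegular f) (hF : ∀ f : F →ₗ[A] Y, StablyRegular f)
    (f : X →ₗ[A] Y) : StablyRegular f := by
  let p := E.projectionOnto F h
  let q := F.projectionOnto E h.symm
  have hpq : ∀ x, (p x : X) + q x = x := fun x => Submodule.projection_add_projection_eq_self h x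
  let f₁ := f ∘ₗ E.subtype
  let f₂ := f ∘ₗ F.subtype
  obtain ⟨s, hs⟩ := hE f₁
  -- The component of `f` on `F` that is not yet in the image of the idempotent `f₁ ∘ s`.
  let g := f₂ - f₁ ∘ₗ s ∘ₗ f₂
  obtain ⟨k, hk⟩ := hF g
  let k' := k ∘ₗ (LinearMap.id - f₁ ∘ₗ s)
  refine ⟨E.subtype ∘ₗ s ∘ₗ (LinearMap.id - f₂ ∘ₗ k') + F.subtype ∘ₗ k', ?_⟩
  convert! ((hs.sub (hs.comp_left (g ∘ₗ k))).comp_right p).add (hk.comp_right q) using 1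
  ext x
  have hx : f x = f₁ (p x) + f₂ (q x) := by
    conv_lhs => rw [← hpq x]
    exact map_add f _ _
  have h1 : ∀ y, f (E.subtype y) = f₁ y := fun _ => rfl
  have h2 : ∀ y, f (F.subtype y) = f₂ y := fun _ => rfl
  simp only [LinearMap.sub_apply, LinearMap.add_apply, LinearMap.comp_apply, map_add, map_sub, hx,
    h1, h2, g, k', LinearMap.id_apply]
  abel

/-- Regularity of all maps `X → Y` follows from regularity on the summands of `Y`. -/
lemma stablyRegular_of_isCompl_right {E F : Submodule A Y} (h : IsCompl E F)
    (hE : ∀ f : X →ₗ[A] E, StablyRegular f) (hF : ∀ f : X →ₗ[A] F, StablyRegular f)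
    (f : X →ₗ[A] Y) : StablyRegular f := by
  let p := E.projectionOnto F h
  let q := F.projectionOnto E h.symm
  have hpq : ∀ x, (p x : Y) + q x = x := fun x => Submodule.projection_add_projection_eq_self h x
  let f₁ := p ∘ₗ f
  let f₂ := q ∘ₗ f
  obtain ⟨s, hs⟩ := hE f₁
  let g := f₂ - f₂ ∘ₗ s ∘ₗ f₁
  obtain ⟨k, hk⟩ := hF g
  let k' := (LinearMap.id - s ∘ₗ f₁) ∘ₗ k
  refine ⟨(LinearMap.id - k' ∘ₗ f₂) ∘ₗ s ∘ₗ p + k' ∘ₗ q, ?_⟩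
  convert! ((hs.sub (hs.comp_right (k ∘ₗ g))).comp_left E.subtype).add (hk.comp_left F.subtype)
    using 1
  ext x
  have hx : ∀ x, f x = E.subtype (f₁ x) + F.subtype (f₂ x) := fun x => (hpq (f x)).symm
  have h1 : ∀ y, p (f y) = f₁ y := fun _ => rfl
  have h2 : ∀ y, q (f y) = f₂ y := fun _ => rfl
  simp only [LinearMap.sub_apply, LinearMap.add_apply, LinearMap.comp_apply, h1, h2]
  rw [hx x, hx]
  simp only [LinearMap.sub_apply, LinearMap.comp_apply, map_add, map_sub, g, k',
    LinearMap.id_apply]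
  abel

/-! ### Gorenstein projective modules as summands of radicals -/

/-- If the syzygy of `X` in a projective cover `P` is Gorenstein projective and its inclusion into
the radical of `P` is stably regular, then the inclusion splits: a map `P → P` with image in the
radical cannot have fixed points. -/
lemma isRetract_jacobson_of_stablyRegular [IsArtinianRing A] [Module.Finite A P] (p : P →ₗ[A] X)
    (hp : Function.Surjective p) (hrad : LinearMap.ker p ≤ Module.jacobson A P)
    (hX : ExtVanish A X) (h : StablyRegular (Submodule.inclusion hrad)) :
    IsRetract A (Module.jacobson A P) (LinearMap.ker p) := by
  obtain ⟨s, Q, a, b, hQ, hQ', hab⟩ := h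
  obtain ⟨a', ha'⟩ := hX.extend_proj (LinearMap.ker p).subtype Subtype.val_injective p hp
    (LinearMap.exact_subtype_ker_map p) a
  let ρ : P →ₗ[A] P := (Module.jacobson A P).subtype ∘ₗ b ∘ₗ a'
  have hsurj : Function.Surjective (LinearMap.id - ρ : P →ₗ[A] P) :=
    surjective_of_sub_mem_jacobson _ fun y => ⟨y, by simp [ρ]⟩
  have hinj := IsNoetherian.injective_of_surjective_endomorphism _ hsurj
  refine isRetract_of_isUnit (Submodule.inclusion hrad) s ((Module.End.isUnit_iff _).2
    (IsArtinian.bijective_of_injective_endomorphism _ ?_))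
  rw [injective_iff_map_eq_zero]
  intro x hx
  have hx : s (Submodule.inclusion hrad x) = 0 := hx
  have h1 := congrArg Subtype.val (LinearMap.congr_fun hab x)
  simp only [LinearMap.sub_apply, LinearMap.comp_apply, hx, map_zero, sub_zero] at h1
  have h2 : (LinearMap.id - ρ : P →ₗ[A] P) x = 0 := by
    have : (x : P) = b (a x) := h1
    rw [LinearMap.sub_apply, sub_eq_zero]
    refine this.trans ?_
    rw [← ha']
    rfl
  exact Subtype.ext (hinj (h2.trans (map_zero _).symm))

lemma InAdd.torsionless (h : InAdd A M X) (hM : Torsionless A M) : Torsionless A X := by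
  obtain ⟨κ, _, a, b, hab⟩ := h
  intro x hx
  obtain ⟨k, hk⟩ : ∃ k, a k x ≠ 0 := by
    by_contra! h0
    exact hx (by rw [← hab x]; simp [h0])
  obtain ⟨f, hf⟩ := hM _ hk
  exact ⟨f ∘ₗ a k, hf⟩

lemma InAdd.finite (h : InAdd A M X) [Module.Finite A M] : Module.Finite A X := by
  obtain ⟨κ, _, a, b, hab⟩ := h
  exact Module.Finite.of_surjective (∑ k, b k ∘ₗ LinearMap.proj k : (κ → M) →ₗ[A] X)
    fun x => ⟨fun k => a k x, by simpa using hab x⟩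

lemma inAdd_of_gprj [IsArtinianRing A]
    (h : ∀ (X Y : Type u) [AddCommGroup X] [Module A X] [AddCommGroup Y] [Module A Y]
      [Module.Finite A X] [Module.Finite A Y] (f : X →ₗ[A] Y), Torsionless A X →
      Torsionless A Y → StablyRegular f) {G : ModuleCat.{u} A} (hG : gprj A G) :
    InAdd A (Module.jacobson A A × A) G := by
  obtain ⟨hfin, -, P, j, hP, hP', hj, hj1, -⟩ := hG.cosyzygyEmbeddable
  let X := P ⧸ LinearMap.range j
  let p : P →ₗ[A] X := (LinearMap.range j).mkQ
  have hp : Function.Surjective p := Submodule.mkQ_surjective _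
  have hpj : ∀ x, p (j x) = 0 := fun x => (Submodule.Quotient.mk_eq_zero _).2 ⟨x, rfl⟩
  have hX : ExtVanish A X := extVanish_of_projective j p hp (LinearMap.exact_map_mkQ_range j) hj1
  obtain ⟨Q, i, r, hQ, hQ', hri, hir, hrad⟩ := exists_projectiveCover p hp
  have hs : Function.Surjective (p ∘ₗ i) := fun x => by
    obtain ⟨y, rfl⟩ := hp x
    exact ⟨r y, hir y⟩
  have h1 : IsRetract A (Module.jacobson A Q) (LinearMap.ker (p ∘ₗ i)) :=
    isRetract_jacobson_of_stablyRegular (p ∘ₗ i) hs hrad hX (h _ _ _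
      (torsionless_projective.of_injective (Submodule.subtype _) Subtype.val_injective)
      (torsionless_projective.of_injective (Submodule.subtype _) Subtype.val_injective))
  have hradA : InAdd A (Module.jacobson A A × A) (Module.jacobson A A) :=
    InAdd.of_retract (LinearMap.inl A _ _) (LinearMap.fst A _ _) fun _ => rfl
  have hA : InAdd A (Module.jacobson A A × A) A :=
    InAdd.of_retract (LinearMap.inr A _ _) (LinearMap.snd A _ _) fun _ => rfl
  have h2 : InAdd A (Module.jacobson A A × A) (LinearMap.ker (p ∘ₗ i)) := by
    obtain ⟨c, d, hcd⟩ := h1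
    exact (hradA.trans (inAdd_projective (A := A) Q).jacobson).trans (InAdd.of_retract c d hcd)
  -- The complement of the projective cover in `P` is a projective summand of `G`.
  have h3 : InAdd A (Module.jacobson A A × A) (LinearMap.ker r) := by
    have h4 : ∀ y, (LinearMap.id - i ∘ₗ r : P →ₗ[A] P) y ∈ LinearMap.ker r := fun y => by
      simp [hri]
    exact (hA.trans (inAdd_projective (A := A) P)).trans (InAdd.of_retract
      (LinearMap.ker r).subtype ((LinearMap.id - i ∘ₗ r : P →ₗ[A] P).codRestrict _ h4)
      fun x => Subtype.ext (by simp))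
  obtain ⟨g, hg⟩ := exists_factor j hj
    ((i ∘ₗ (LinearMap.ker (p ∘ₗ i)).subtype).coprod (LinearMap.ker r).subtype) (by
    rintro ⟨⟨x, hx⟩, ⟨y, hy⟩⟩
    refine (Submodule.Quotient.mk_eq_zero _).1 (?_ : p (i x + y) = 0)
    rw [map_add, show p (i x) = 0 from hx, ← hir y, LinearMap.mem_ker.1 hy, map_zero, map_zero,
      add_zero])
  refine (h2.prod h3).trans (InAdd.of_retract
    (((r ∘ₗ j).codRestrict (LinearMap.ker (p ∘ₗ i)) fun x => ?_).prod
      ((j - i ∘ₗ r ∘ₗ j).codRestrict (LinearMap.ker r) fun x => ?_)) g fun x => hj ?_)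
  · rw [LinearMap.mem_ker, LinearMap.comp_apply, LinearMap.comp_apply, hir, hpj]
  · simp [hri]
  · rw [hg]
    simp

end Regular

/-! ### Regularity of all stable maps -/

section AllRegular

variable {A : Type u} [Ring A]

variable {X Y Z P Q M N : Type u} [AddCommGroup X] [Module A X] [AddCommGroup Y] [Module A Y]
  [AddCommGroup Z] [Module A Z] [AddCommGroup P] [Module A P] [AddCommGroup Q] [Module A Q]
  [AddCommGroup M] [Module A M] [AddCommGroup N] [Module A N]

/-- Regularity modulo projectives of the map `f' : ker p → ker q` on syzygies: since maps from
`ker p` to projective modules extend to `P`, those that factor through a projective module are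
those that extend to `P`. It implies regularity of the map `f` that `f'` comes from. -/
lemma stablyRegular_of_syzygy [Module.Finite A P] [Module.Projective A P] [Module.Finite A Q]
    [Module.Projective A Q] (p : P →ₗ[A] X) (hp : Function.Surjective p) (q : Q →ₗ[A] Y)
    (hq : Function.Surjective q) (hY : ExtVanish A Y) (f : X →ₗ[A] Y) (F : P →ₗ[A] Q)
    (hF : ∀ x, q (F x) = f (p x)) (f' : LinearMap.ker p →ₗ[A] LinearMap.ker q)
    (hf' : ∀ n, (f' n : Q) = F n) (s' : LinearMap.ker q →ₗ[A] LinearMap.ker p)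
    (t : P →ₗ[A] LinearMap.ker q) (ht : ∀ n : LinearMap.ker p, f' n - f' (s' (f' n)) = t n) :
    StablyRegular f := by
  obtain ⟨S, hS⟩ := hY.extend_proj (LinearMap.ker q).subtype Subtype.val_injective q hq
    (LinearMap.exact_subtype_ker_map q) ((LinearMap.ker p).subtype ∘ₗ s')
  obtain ⟨s, hs⟩ := exists_desc q hq (p ∘ₗ S) (fun y hy => by
    have := hS ⟨y, hy⟩
    rw [LinearMap.comp_apply, show S y = s' ⟨y, hy⟩ from this]
    exact (s' ⟨y, hy⟩).2)
  obtain ⟨g, hg⟩ := exists_desc p hp (F - F ∘ₗ S ∘ₗ F - (LinearMap.ker q).subtype ∘ₗ t)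
    (fun x hx => by
      have h1 := congrArg Subtype.val (ht ⟨x, hx⟩)
      have h2 : F x = f' ⟨x, hx⟩ := (hf' ⟨x, hx⟩).symm
      have h3 : S (F x) = s' (f' ⟨x, hx⟩) := by
        rw [h2]
        exact hS (f' ⟨x, hx⟩)
      have h4 : F (S (F x)) = f' (s' (f' ⟨x, hx⟩)) := by rw [h3, hf']
      have h1 : (f' ⟨x, hx⟩ : Q) - f' (s' (f' ⟨x, hx⟩)) = t x := h1
      simp only [LinearMap.sub_apply, LinearMap.comp_apply, Submodule.subtype_apply]
      rw [h4, h2, h1, sub_self])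
  refine ⟨s, ModuleCat.of A Q, g, q, inferInstanceAs (Module.Finite A Q),
    inferInstanceAs (Module.Projective A Q), LinearMap.ext fun x => ?_⟩
  obtain ⟨y, rfl⟩ := hp x
  have hsF : s (f (p y)) = p (S (F y)) := by
    rw [← hF, hs]
    rfl
  simp only [LinearMap.sub_apply, LinearMap.comp_apply, hg, map_sub, hF, hsF]
  simp

/-- If the map from `M` to the pushout of `f' : ker p → M` along `ker p → P` is stably regular,
then so is `f'`. In the triangulated structure of the stable category this says that a map is
regular if the next map in its triangle is. -/
lemma exists_regular_of_pushout [Module.Finite A P] [Module.Projective A P] (p : P →ₗ[A] X)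
    (hp : Function.Surjective p) (hX : ExtVanish A X) (hX' : Torsionless A X)
    [Module.Finite A M] (hM : Torsionless A M) (f' : LinearMap.ker p →ₗ[A] M)
    (h : ∀ (C : Type u) [AddCommGroup C] [Module A C] [Module.Finite A C] (g : M →ₗ[A] C),
      Torsionless A C → StablyRegular g) :
    ∃ (s' : M →ₗ[A] LinearMap.ker p) (t : P →ₗ[A] M),
      ∀ n : LinearMap.ker p, f' n - f' (s' (f' n)) = t n := by
  let K := LinearMap.range (f'.prod (-(LinearMap.ker p).subtype))
  have hK : ∀ m x, (m, x) ∈ K ↔ ∃ n, f' n = m ∧ -(n : P) = x := fun m x => by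
    simp [K, LinearMap.mem_range, Prod.ext_iff]
  let π : M × P →ₗ[A] (M × P) ⧸ K := K.mkQ
  have hπ : Function.Surjective π := K.mkQ_surjective
  have hπ0 : ∀ m x, π (m, x) = 0 ↔ ∃ n, f' n = m ∧ -(n : P) = x := fun m x => by
    rw [← hK]
    exact Submodule.Quotient.mk_eq_zero K
  let g : M →ₗ[A] (M × P) ⧸ K := π ∘ₗ LinearMap.inl A M P
  have hC : Torsionless A ((M × P) ⧸ K) := by
    obtain ⟨e, he⟩ := exists_desc π hπ (p ∘ₗ LinearMap.snd A M P) (fun y hy => by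
      obtain ⟨n, -, hn⟩ := (hπ0 y.1 y.2).1 hy
      change p y.2 = 0
      rw [← hn, map_neg, LinearMap.mem_ker.1 n.2, neg_zero])
    refine hM.extension hX' hX g ?_ e (fun x => ?_) (fun c => ⟨fun hc => ?_, ?_⟩)
    · rw [injective_iff_map_eq_zero]
      intro m hm
      obtain ⟨n, hn, hn'⟩ := (hπ0 m 0).1 hm
      rw [← hn, show n = 0 from Subtype.ext (neg_eq_zero.1 hn'), map_zero]
    · obtain ⟨y, rfl⟩ := hp x
      exact ⟨π (0, y), he (0, y)⟩
    · obtain ⟨⟨m, x⟩, rfl⟩ := hπ c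
      have hx : p x = 0 := (he (m, x)).symm.trans hc
      refine ⟨m + f' ⟨x, hx⟩, ?_⟩
      rw [← sub_eq_zero]
      change π (m + f' ⟨x, hx⟩, 0) - π (m, x) = 0
      rw [← map_sub, Prod.mk_sub_mk, hπ0]
      exact ⟨⟨x, hx⟩, (add_sub_cancel_left _ _).symm, (zero_sub x).symm⟩
    · rintro ⟨m, rfl⟩
      exact (he (m, 0)).trans (map_zero p)
  obtain ⟨s, R, a, b, hR, hR', hab⟩ := h _ g hC
  obtain ⟨b', hb'⟩ := exists_lift π hπ b
  have hmem : ∀ m, ((LinearMap.snd A M P ∘ₗ b' ∘ₗ a) m) ∈ LinearMap.ker p ∧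
      ∀ hm, f' ⟨(b' (a m)).2, hm⟩ = m - s (g m) - (b' (a m)).1 := fun m => by
    have h1 := LinearMap.congr_fun hab m
    have h2 : π ((m - s (g m), 0) - b' (a m)) = 0 := by
      rw [map_sub, hb', sub_eq_zero]
      refine Eq.trans ?_ h1
      change g (m - s (g m)) = _
      rw [map_sub]
      rfl
    obtain ⟨n, hn, hn'⟩ := (hπ0 _ _).1 h2
    have h3 : (n : P) = (b' (a m)).2 := by simpa using hn'
    refine ⟨?_, fun hm => ?_⟩
    · change (b' (a m)).2 ∈ _
      rw [← h3]
      exact n.2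
    · rw [← show n = ⟨_, hm⟩ from Subtype.ext h3, hn]
  -- `g ∘ f'` extends to `P`, and so does the map from `ker p` to a projective module.
  obtain ⟨c, hc⟩ := hX.extend_proj (LinearMap.ker p).subtype Subtype.val_injective p hp
    (LinearMap.exact_subtype_ker_map p) (a ∘ₗ f')
  refine ⟨(LinearMap.snd A M P ∘ₗ b' ∘ₗ a).codRestrict _ fun m => (hmem m).1,
    s ∘ₗ π ∘ₗ LinearMap.inr A M P + LinearMap.fst A M P ∘ₗ b' ∘ₗ c, fun n => ?_⟩
  have h1 : f' ((LinearMap.snd A M P ∘ₗ b' ∘ₗ a).codRestrict _ (fun m => (hmem m).1) (f' n)) =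
      f' n - s (g (f' n)) - (b' (a (f' n))).1 := (hmem (f' n)).2 _
  have h2 : g (f' n) = π (0, (n : P)) := by
    rw [← sub_eq_zero]
    change π (f' n, 0) - π (0, (n : P)) = 0
    rw [← map_sub, Prod.mk_sub_mk, sub_zero, zero_sub]
    exact (hπ0 _ _).2 ⟨n, rfl, rfl⟩
  have h3 : c n = a (f' n) := hc n
  rw [h1, h2]
  simp only [LinearMap.add_apply, LinearMap.comp_apply, LinearMap.inr_apply, h3,
    LinearMap.fst_apply]
  abel

/-- The syzygy in a projective cover inherits a local endomorphism ring, as its endomorphisms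
extend to the projective cover. -/
lemma LocalEnd.syzygy [IsArtinianRing A] [Module.Finite A P] [Module.Projective A P]
    (p : P →ₗ[A] X) (hp : Function.Surjective p)
    (hrad : ∀ x, p x = 0 → x ∈ Module.jacobson A P) (hX : ExtVanish A X) (h : LocalEnd A X) :
    LocalEnd A (LinearMap.ker p) := by
  have key : ∀ (f : Module.End A (LinearMap.ker p)) (F : P →ₗ[A] P) (φ : Module.End A X),
      (∀ n : LinearMap.ker p, F n = f n) → (∀ x, φ (p x) = p (F x)) → IsUnit φ → IsUnit f := by
    intro f F φ hF hφ hu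
    have hsurj : Function.Surjective F := surjective_of_sub_mem_jacobson F fun y => by
      obtain ⟨x, hx⟩ := ((Module.End.isUnit_iff _).1 hu).2 (p y)
      obtain ⟨z, rfl⟩ := hp x
      exact ⟨z, hrad _ (by rw [map_sub, ← hx, hφ, sub_self])⟩
    have hinj := IsNoetherian.injective_of_surjective_endomorphism _ hsurj
    refine (Module.End.isUnit_iff _).2 (IsArtinian.bijective_of_injective_endomorphism f
      fun a b hab => Subtype.ext (hinj ?_))
    rw [hF, hF, hab]
  intro f
  obtain ⟨F, hF⟩ := hX.extend_proj (LinearMap.ker p).subtype Subtype.val_injective p hp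
    (LinearMap.exact_subtype_ker_map p) ((LinearMap.ker p).subtype ∘ₗ f)
  obtain ⟨φ, hφ⟩ := exists_desc p hp (p ∘ₗ F) (fun x hx => by
    rw [LinearMap.comp_apply, show F x = f ⟨x, hx⟩ from hF ⟨x, hx⟩]
    exact (f ⟨x, hx⟩).2)
  rcases h φ with hu | hu
  · exact Or.inl (key f F φ hF hφ hu)
  · refine Or.inr (key (1 - f) (LinearMap.id - F) (1 - φ) (fun n => ?_) (fun x => ?_) hu)
    · rw [LinearMap.sub_apply, show F n = f n from hF n]
      rfl
    · rw [LinearMap.sub_apply, LinearMap.sub_apply, map_sub, hφ]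
      rfl

lemma projective_of_extend_id [Module.Projective A P] (p : P →ₗ[A] X)
    (hp : Function.Surjective p) (t : P →ₗ[A] LinearMap.ker p)
    (ht : ∀ n : LinearMap.ker p, t n = n) : Module.Projective A X := by
  obtain ⟨s, hs⟩ := exists_desc p hp (LinearMap.id - (LinearMap.ker p).subtype ∘ₗ t)
    (fun x hx => by
      have := ht ⟨x, hx⟩
      have : t x = ⟨x, hx⟩ := this
      simp [this])
  refine projective_of_retract s p fun x => ?_
  obtain ⟨y, rfl⟩ := hp x
  rw [hs]
  simp

lemma projective_of_projective_syzygy [Module.Finite A P] [Module.Projective A P]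
    (p : P →ₗ[A] X) (hp : Function.Surjective p) (hX : ExtVanish A X)
    [Module.Finite A (LinearMap.ker p)] [Module.Projective A (LinearMap.ker p)] :
    Module.Projective A X := by
  obtain ⟨t, ht⟩ := hX.extend_proj (LinearMap.ker p).subtype Subtype.val_injective p hp
    (LinearMap.exact_subtype_ker_map p) LinearMap.id
  exact projective_of_extend_id p hp t ht

/-- The syzygy of a non-projective module with local endomorphism ring, if it is a summand of a
sum of copies of `rad A` and `A`, is a summand of the radical of a projective module with
simple top. -/
lemma LocalEnd.exists_simple_top_syzygy [IsArtinianRing A] [Module.Finite A P]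
    [Module.Projective A P] (p : P →ₗ[A] X) (hp : Function.Surjective p) (hX : ExtVanish A X)
    (hXp : ¬ Module.Projective A X) (hloc : LocalEnd A (LinearMap.ker p))
    (hadd : InAdd A (Module.jacobson A A × A) (LinearMap.ker p)) :
    ∃ Q : ModuleCat.{u} A, Module.Finite A Q ∧ Module.Projective A Q ∧
      IsSimpleModule A (Q ⧸ Module.jacobson A Q) ∧
      IsRetract A (Module.jacobson A Q) (LinearMap.ker p) := by
  have hnt : Nontrivial (LinearMap.ker p) := by
    by_contra hn
    rw [not_nontrivial_iff_subsingleton] at hn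
    exact hXp (projective_of_extend_id p hp 0 fun n => Subsingleton.elim _ _)
  rcases hloc.isRetract_prod (hloc.isRetract_of_inAdd hadd) with h | ⟨i, r, hir⟩
  · exact hloc.exists_simple_top h
  · have := projective_of_retract i r hir
    exact absurd (projective_of_projective_syzygy p hp hX) hXp

/-- Let `N → M` be a map of syzygies, let `N` and `M` be summands of the radicals of projective
modules `P'` and `Q'` with simple tops, and extend all maps to the projective modules `P` and `Q`
containing `N` and `M`. Comparing the two maps from `P` to the tops of `P'` and `Q'`, either the
map is regular modulo maps that extend to `P`, or `P` maps onto `P' × Q'`. -/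
lemma exists_regular_or_surjective [IsArtinianRing A] [Module.Finite A P] [Module.Projective A P]
    (p : P →ₗ[A] X) (hp : Function.Surjective p) (hXp : ¬ Module.Projective A X)
    (q : Q →ₗ[A] Y) (F : P →ₗ[A] Q) (f' : LinearMap.ker p →ₗ[A] LinearMap.ker q)
    (hf' : ∀ n, (f' n : Q) = F n) {P' Q' : Type u} [AddCommGroup P'] [Module A P']
    [AddCommGroup Q'] [Module A Q'] [Module.Finite A P'] [Module.Finite A Q']
    [Module.Projective A Q']
    [IsSimpleModule A (P' ⧸ Module.jacobson A P')] [IsSimpleModule A (Q' ⧸ Module.jacobson A Q')]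
    (i : LinearMap.ker p →ₗ[A] Module.jacobson A P')
    (r : Module.jacobson A P' →ₗ[A] LinearMap.ker p) (hir : ∀ x, r (i x) = x)
    (j : LinearMap.ker q →ₗ[A] Module.jacobson A Q')
    (s : Module.jacobson A Q' →ₗ[A] LinearMap.ker q) (hjs : ∀ x, s (j x) = x)
    (I : P →ₗ[A] P') (hI : ∀ x : LinearMap.ker p, I x = i x)
    (J : Q →ₗ[A] Q') (hJ : ∀ x : LinearMap.ker q, J x = j x) :
    (∃ (s' : LinearMap.ker q →ₗ[A] LinearMap.ker p) (t : P →ₗ[A] LinearMap.ker q),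
      ∀ n : LinearMap.ker p, f' n - f' (s' (f' n)) = t n) ∨
    Function.Surjective (I.prod (J ∘ₗ F)) := by
  let a := (Module.jacobson A P').mkQ ∘ₗ I
  let b := (Module.jacobson A Q').mkQ ∘ₗ J ∘ₗ F
  have ha0 : ∀ x, a x = 0 ↔ I x ∈ Module.jacobson A P' := fun x =>
    Submodule.Quotient.mk_eq_zero _
  have hb0 : ∀ x, b x = 0 ↔ J (F x) ∈ Module.jacobson A Q' := fun x =>
    Submodule.Quotient.mk_eq_zero _
  have hJF : ∀ n : LinearMap.ker p, J (F n) = j (f' n) := fun n => by rw [← hJ, hf']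
  have ha : a ≠ 0 := fun ha => hXp (projective_of_extend_id p hp
    (r ∘ₗ I.codRestrict _ fun x => (ha0 x).1 (LinearMap.congr_fun ha x)) fun n => by
      rw [LinearMap.comp_apply, show I.codRestrict (Module.jacobson A P') _ n = i n from
        Subtype.ext (hI n), hir])
  by_cases hb : b = 0
  · refine Or.inl ⟨0, s ∘ₗ (J ∘ₗ F).codRestrict _
      fun x => (hb0 x).1 (LinearMap.congr_fun hb x), fun n => ?_⟩
    rw [LinearMap.comp_apply, show (J ∘ₗ F).codRestrict (Module.jacobson A Q') _ n = j (f' n) from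
      Subtype.ext (hJF n), hjs]
    simp
  have has : Function.Surjective a := LinearMap.surjective_of_ne_zero ha
  have hbs : Function.Surjective b := LinearMap.surjective_of_ne_zero hb
  by_cases hab : ∀ x, a x = 0 → b x = 0
  · -- The two maps to simple tops agree up to an isomorphism `θ`; lifted to the projective
    -- modules, its inverse yields a stable left inverse of `f'`.
    left
    obtain ⟨θ, hθ⟩ := exists_desc a has b hab
    have hθ0 : θ ≠ 0 := fun h0 => hb (LinearMap.ext fun x => by rw [← hθ, h0]; rfl)
    let e := LinearEquiv.ofBijective θ (LinearMap.bijective_of_ne_zero hθ0)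
    obtain ⟨T, hT⟩ := exists_lift (Module.jacobson A P').mkQ (Submodule.mkQ_surjective _)
      (e.symm.toLinearMap ∘ₗ (Module.jacobson A Q').mkQ)
    have hδ : ∀ x, (T ∘ₗ J ∘ₗ F - I) x ∈ Module.jacobson A P' := fun x => by
      rw [← Submodule.ker_mkQ (Module.jacobson A P'), LinearMap.mem_ker, LinearMap.sub_apply,
        map_sub, LinearMap.comp_apply, hT]
      change e.symm (b x) - a x = 0
      rw [← hθ, sub_eq_zero]
      exact e.symm_apply_apply (a x)
    refine ⟨r ∘ₗ radMap T ∘ₗ j, -(f' ∘ₗ r ∘ₗ (T ∘ₗ J ∘ₗ F - I).codRestrict _ hδ), fun n => ?_⟩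
    have h1 : radMap T (j (f' n)) = (T ∘ₗ J ∘ₗ F - I).codRestrict _ hδ n + i n := by
      apply Subtype.ext
      change T (j (f' n)) = T (J (F n)) - I n + i n
      rw [hJF, hI, sub_add_cancel]
    simp only [LinearMap.comp_apply, LinearMap.neg_apply, h1, map_add, hir]
    abel
  · right
    push Not at hab
    obtain ⟨x₀, hx₀, hx₀'⟩ := hab
    have hbk : Function.Surjective (b ∘ₗ (LinearMap.ker a).subtype) :=
      LinearMap.surjective_of_ne_zero fun h0 => hx₀' (LinearMap.congr_fun h0 ⟨x₀, hx₀⟩)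
    refine surjective_of_sub_mem_jacobson _ ?_
    rintro ⟨u, v⟩
    obtain ⟨x, hx⟩ := has ((Module.jacobson A P').mkQ u)
    obtain ⟨⟨y, hy⟩, hxy⟩ := hbk ((Module.jacobson A Q').mkQ v - b x)
    have hy : a y = 0 := hy
    have hxy : b y = (Module.jacobson A Q').mkQ v - b x := hxy
    have h1 : u - I (x + y) ∈ Module.jacobson A P' := by
      rw [← Submodule.ker_mkQ (Module.jacobson A P'), LinearMap.mem_ker, map_sub, ← hx]
      change a x - a (x + y) = 0
      rw [map_add, hy, add_zero, sub_self]
    have h2 : v - J (F (x + y)) ∈ Module.jacobson A Q' := by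
      rw [← Submodule.ker_mkQ (Module.jacobson A Q'), LinearMap.mem_ker, map_sub]
      change (Module.jacobson A Q').mkQ v - b (x + y) = 0
      rw [map_add, hxy]
      abel
    refine ⟨x + y, ?_⟩
    have h3 : LinearMap.inl A P' Q' (u - I (x + y)) ∈ Module.jacobson A (P' × Q') :=
      Module.le_comap_jacobson _ h1
    have h4 : LinearMap.inr A P' Q' (v - J (F (x + y))) ∈ Module.jacobson A (P' × Q') :=
      Module.le_comap_jacobson _ h2
    convert! Submodule.add_mem _ h3 h4 using 1
    ext <;> simp

/-- The induction step: if all maps from modules shorter than `X` are regular, and `X` and `Y`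
have local endomorphism rings, then all maps `X → Y` are regular. -/
lemma stablyRegular_of_localEnd [IsArtinianRing A] (h : TorsionlessIffExtVanish A)
    (hadd : ∀ (X : Type u) [AddCommGroup X] [Module A X] [Module.Finite A X],
      Torsionless A X → InAdd A (Module.jacobson A A × A) X)
    [Module.Finite A X] [Module.Finite A Y] (hX : Torsionless A X) (hY : Torsionless A Y)
    (hXl : LocalEnd A X) (hYl : LocalEnd A Y)
    (ih : ∀ (M C : Type u) [AddCommGroup M] [Module A M] [AddCommGroup C] [Module A C]
      [Module.Finite A M] [Module.Finite A C] (g : M →ₗ[A] C), Torsionless A M →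
      Torsionless A C → Module.length A M < Module.length A X → StablyRegular g)
    (f : X →ₗ[A] Y) : StablyRegular f := by
  by_cases hXp : Module.Projective A X
  · exact (stablyZero_of_projective_left f).stablyRegular
  by_cases hYp : Module.Projective A Y
  · exact (stablyZero_of_projective_right f).stablyRegular
  obtain ⟨P, p, hP, hP', hp, hprad⟩ := exists_cover_of_finite (A := A) X
  obtain ⟨Q, q, hQ, hQ', hq, hqrad⟩ := exists_cover_of_finite (A := A) Y
  have hXe := (h X).1 hX
  have hYe := (h Y).1 hY
  have hN : Torsionless A (LinearMap.ker p) :=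
    torsionless_projective.of_injective (Submodule.subtype _) Subtype.val_injective
  have hM : Torsionless A (LinearMap.ker q) :=
    torsionless_projective.of_injective (Submodule.subtype _) Subtype.val_injective
  obtain ⟨P', hPf, hPp, hPs, i, r, hir⟩ := (hXl.syzygy p hp hprad hXe).exists_simple_top_syzygy
    p hp hXe hXp (hadd _ hN)
  obtain ⟨Q', hQf, hQp, hQs, j, s, hjs⟩ := (hYl.syzygy q hq hqrad hYe).exists_simple_top_syzygy
    q hq hYe hYp (hadd _ hM)
  obtain ⟨F, hF⟩ := exists_lift q hq (f ∘ₗ p)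
  let f' : LinearMap.ker p →ₗ[A] LinearMap.ker q := F.restrict fun x hx => by
    rw [LinearMap.mem_ker, hF, LinearMap.comp_apply, LinearMap.mem_ker.1 hx, map_zero]
  obtain ⟨I, hI⟩ := hXe.extend_proj (LinearMap.ker p).subtype Subtype.val_injective p hp
    (LinearMap.exact_subtype_ker_map p) ((Module.jacobson A P').subtype ∘ₗ i)
  obtain ⟨J, hJ⟩ := hYe.extend_proj (LinearMap.ker q).subtype Subtype.val_injective q hq
    (LinearMap.exact_subtype_ker_map q) ((Module.jacobson A Q').subtype ∘ₗ j)
  suffices hreg : ∃ (s' : LinearMap.ker q →ₗ[A] LinearMap.ker p) (t : P →ₗ[A] LinearMap.ker q),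
      ∀ n : LinearMap.ker p, f' n - f' (s' (f' n)) = t n by
    obtain ⟨s', t, ht⟩ := hreg
    exact stablyRegular_of_syzygy p hp q hq hYe f F hF f' (fun _ => rfl) s' t ht
  rcases exists_regular_or_surjective p hp hXp q F f' (fun _ => rfl) i r hir j s hjs I hI J hJ
    with hreg | hsurj
  · exact hreg
  · have hlen : ∀ {B : Type u} [AddCommGroup B] [Module A B] [Module.Finite A B] {N : Type u}
        [AddCommGroup N] [Module A N] [IsSimpleModule A (B ⧸ Module.jacobson A B)]
        (i : N →ₗ[A] Module.jacobson A B) (r : Module.jacobson A B →ₗ[A] N),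
        (∀ x, r (i x) = x) → Module.length A N < Module.length A B := by
      intro B _ _ _ N _ _ _ i r hir
      refine (Module.length_le_of_injective i (Function.LeftInverse.injective hir)).trans_lt
        (Submodule.length_lt ?_)
      exact (isSimpleModule_iff_isCoatom.1 inferInstance).1
    have h1 := hlen i r hir
    have h2 := hlen j s hjs
    have h3 := Module.length_le_of_surjective _ hsurj
    rw [Module.length_prod, Module.length_eq_add_of_exact (LinearMap.ker p).subtype p
      Subtype.val_injective hp (LinearMap.exact_subtype_ker_map p)] at h3
    have h4 : Module.length A (LinearMap.ker q) < Module.length A X := by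
      have h5 : Module.length A (LinearMap.ker p) + Module.length A (LinearMap.ker q) <
          Module.length A (LinearMap.ker p) + Module.length A X :=
        (ENat.add_lt_add_of_le_of_lt Module.length_ne_top h1.le h2).trans_le h3
      exact lt_of_add_lt_add_left h5
    exact exists_regular_of_pushout p hp hXe hX hM f' fun C _ _ _ g hC => ih _ _ g hM hC h4

/-- If every torsionless module is a summand of a sum of copies of `rad A` and `A`, then all maps
between torsionless modules are stably regular. The induction on the lengths of `X` and `Y`
reduces to modules with local endomorphism rings. -/
theorem stablyRegular_of_inAdd [IsArtinianRing A] (h : TorsionlessIffExtVanish A)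
    (hadd : ∀ (X : Type u) [AddCommGroup X] [Module A X] [Module.Finite A X],
      Torsionless A X → InAdd A (Module.jacobson A A × A) X)
    [Module.Finite A X] [Module.Finite A Y] (hX : Torsionless A X) (hY : Torsionless A Y)
    (f : X →ₗ[A] Y) : StablyRegular f := by
  induction hl : Module.length A X using WellFoundedLT.induction generalizing X Y with
  | ind l ihX =>
  subst hl
  induction hl : Module.length A Y using WellFoundedLT.induction generalizing Y with
  | ind l ihY =>
  subst hl
  rcases localEnd_or_isCompl (A := A) (M := X) with hXl | ⟨E, E', hE, hE1, hE2⟩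
  · rcases localEnd_or_isCompl (A := A) (M := Y) with hYl | ⟨E, E', hE, hE1, hE2⟩
    · exact stablyRegular_of_localEnd h hadd hX hY hXl hYl
        (fun M C _ _ _ _ _ _ g hM hC hlt => ihX _ hlt hM hC g rfl) f
    · exact stablyRegular_of_isCompl_right hE
        (fun f => ihY _ (Submodule.length_lt hE1)
          (hY.of_injective E.subtype Subtype.val_injective) f rfl)
        (fun f => ihY _ (Submodule.length_lt hE2)
          (hY.of_injective E'.subtype Subtype.val_injective) f rfl) f
  · exact stablyRegular_of_isCompl_left hE
      (fun f => ihX _ (Submodule.length_lt hE1)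
        (hX.of_injective E.subtype Subtype.val_injective) hY f rfl)
      (fun f => ihX _ (Submodule.length_lt hE2)
        (hX.of_injective E'.subtype Subtype.val_injective) hY f rfl) f

end AllRegular

/-! ### Semisimple categories of finitely presented functors -/

section Regular

variable {C : Type w} [Category.{v} C]

/-- Von Neumann regularity of a morphism: `f` has a generalised inverse `s`. -/
def IsRegularMor {X Y : C} (f : X ⟶ Y) : Prop := ∃ s : Y ⟶ X, f ≫ s ≫ f = f

/-- A class of objects that is stable under retracts and has only regular morphisms is closed
under kernels: the kernel of `f` is the image of the idempotent `1 - f ≫ s`. -/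
lemma isClosedUnderKernels_of_isRegularMor [Preadditive C] (P : ObjectProperty C)
    [P.IsStableUnderRetracts]
    (h : ∀ ⦃X Y : C⦄ (f : X ⟶ Y), P X → P Y → IsRegularMor f) : P.IsClosedUnderKernels where
  kernels_le := by
    rintro _ ⟨f, k, hk, hX, hY⟩
    obtain ⟨s, hs⟩ := h f hX hY
    let e := hk.lift (Limits.KernelFork.ofι (𝟙 _ - f ≫ s) (by simp [hs]))
    have he : e ≫ k.ι = 𝟙 _ - f ≫ s := hk.fac _ Limits.WalkingParallelPair.zero
    refine P.prop_of_retract ⟨k.ι, e, ?_⟩ hX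
    refine Limits.Fork.IsLimit.hom_ext hk ?_
    have hk0 : k.ι ≫ f = 0 := k.condition
    rw [Category.assoc, he, Preadditive.comp_sub, ← Category.assoc k.ι f, hk0]
    simp

lemma isClosedUnderCokernels_of_isRegularMor [Preadditive C] (P : ObjectProperty C)
    [P.IsStableUnderRetracts]
    (h : ∀ ⦃X Y : C⦄ (f : X ⟶ Y), P X → P Y → IsRegularMor f) : P.IsClosedUnderCokernels where
  cokernels_le := by
    rintro _ ⟨f, k, hk, hX, hY⟩
    obtain ⟨s, hs⟩ := h f hX hY
    let e := hk.desc (Limits.CokernelCofork.ofπ (𝟙 _ - s ≫ f) (by simp [hs]))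
    have he : k.π ≫ e = 𝟙 _ - s ≫ f := hk.fac _ Limits.WalkingParallelPair.one
    refine P.prop_of_retract ⟨e, k.π, ?_⟩ hY
    refine Limits.Cofork.IsColimit.hom_ext hk ?_
    have hk0 : f ≫ k.π = 0 := k.condition
    rw [← Category.assoc, he, Preadditive.sub_comp, Category.assoc, hk0]
    simp

/-- In a category with only regular morphisms every epimorphism splits. -/
lemma projective_of_isRegularMor (h : ∀ ⦃X Y : C⦄ (f : X ⟶ Y), IsRegularMor f) (X : C) :
    Projective X where
  factors {E Y} f e he := by
    obtain ⟨s, hs⟩ := h e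
    have hse : s ≫ e = 𝟙 _ := by rw [← cancel_epi e, hs, Category.comp_id]
    exact ⟨f ≫ s, by rw [Category.assoc, hse, Category.comp_id]⟩

/-- If all morphisms of `C` are regular and `y` is full, then all morphisms between retracts of
objects in the image of `y` are regular. -/
lemma isRegularMor_of_retract {D : Type*} [Category D] (y : C ⥤ D) [y.Full]
    (h : ∀ ⦃X Y : C⦄ (f : X ⟶ Y), IsRegularMor f) {F G : D} {X Y : C}
    (a : Retract F (y.obj X)) (b : Retract G (y.obj Y)) (φ : F ⟶ G) : IsRegularMor φ := by
  obtain ⟨s, hs⟩ := h (y.preimage (a.r ≫ φ ≫ b.i))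
  replace hs := congrArg y.map hs
  rw [y.map_comp, y.map_comp, y.map_preimage] at hs
  refine ⟨b.i ≫ y.map s ≫ a.r, ?_⟩
  have := congrArg (fun t => a.i ≫ t ≫ b.r) hs
  simpa using this

lemma epi_of_app_surjective {F G : Cᵒᵖ ⥤ AddCommGrpCat.{v}} (p : F ⟶ G)
    (hp : ∀ Z, Function.Surjective (p.app Z)) : Epi p := by
  have : ∀ Z, Epi (p.app Z) := fun Z => (AddCommGrpCat.epi_iff_surjective _).2 (hp Z)
  exact NatTrans.epi_of_epi_app p

end Regular

section FinPres

variable {C : Type w} [Category.{v} C] [Preadditive C]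

lemma additive_of_retract {F G : Cᵒᵖ ⥤ AddCommGrpCat.{v}} (a : Retract F G) [G.Additive] :
    F.Additive where
  map_add {X Y f g} := by
    have key : ∀ h : X ⟶ Y, F.map h = a.i.app X ≫ G.map h ≫ a.r.app Y := fun h => by
      rw [a.r.naturality, ← Category.assoc, ← NatTrans.comp_app, a.retract, NatTrans.id_app,
        Category.id_comp]
    rw [key, key f, key g, G.map_add, Preadditive.add_comp, Preadditive.comp_add]

lemma finPresFunctor_of_retract {F : Cᵒᵖ ⥤ AddCommGrpCat.{v}} {X : C}
    (a : Retract F (preadditiveYoneda.obj X)) : finPresFunctor C F := by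
  refine ⟨additive_of_retract a, ?_⟩
  obtain ⟨e, he⟩ := preadditiveYoneda.map_surjective (a.r ≫ a.i)
  have h1 : ∀ (Z : Cᵒᵖ) (x : F.obj Z), a.r.app Z (a.i.app Z x) = x := fun Z x =>
    congrArg (fun t : F ⟶ F => t.app Z x) a.retract
  have h2 : ∀ (Z : Cᵒᵖ) (x : Z.unop ⟶ X), a.i.app Z (a.r.app Z x) = x ≫ e := fun Z x =>
    (congrArg (fun t : preadditiveYoneda.obj X ⟶ preadditiveYoneda.obj X => t.app Z x) he).symm
  refine ⟨X, X, 𝟙 X - e, a.r, fun Z => ⟨fun x => ⟨fun hx => ?_, ?_⟩, fun x => ⟨_, h1 Z x⟩⟩⟩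
  · refine ⟨x, ?_⟩
    have h3 := h2 Z x
    rw [hx, map_zero] at h3
    change Z.unop ⟶ X at x
    change x ≫ (𝟙 X - e) = x
    rw [Preadditive.comp_sub, ← h3, Category.comp_id]
    exact sub_zero _
  · rintro ⟨y, rfl⟩
    change Z.unop ⟶ X at y
    change a.r.app Z (y ≫ (𝟙 X - e)) = 0
    rw [Preadditive.comp_sub, Category.comp_id, ← h2]
    exact (map_sub (a.r.app Z).hom y (a.i.app Z (a.r.app Z y))).trans
      (sub_eq_zero.2 (h1 Z (a.r.app Z y)).symm)

/-- If all morphisms of `C` are regular, the finitely presented functors are the retracts of the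
representable ones. -/
lemma exists_retract_of_finPresFunctor
    (h : ∀ ⦃X Y : C⦄ (f : X ⟶ Y), IsRegularMor f) {F : Cᵒᵖ ⥤ AddCommGrpCat.{v}}
    (hF : finPresFunctor C F) : ∃ X : C, Nonempty (Retract F (preadditiveYoneda.obj X)) := by
  obtain ⟨-, X, X', f, p, hp⟩ := hF
  obtain ⟨s, hs⟩ := h f
  have hepi : Epi p := epi_of_app_surjective p fun Z => (hp Z).2
  have hfp : preadditiveYoneda.map f ≫ p = 0 := by
    ext Z x
    exact (hp Z).1.apply_apply_eq_zero x
  -- As `f ≫ (𝟙 X' - s ≫ f) = 0`, this idempotent descends along `p`.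
  have hker : Limits.kernel.ι p ≫ preadditiveYoneda.map (𝟙 X' - s ≫ f) = 0 := by
    ext Z x
    have h0 : p.app Z ((Limits.kernel.ι p).app Z x) = 0 :=
      congrArg (fun t : Limits.kernel p ⟶ F => t.app Z x) (Limits.kernel.condition p)
    obtain ⟨y, hy⟩ := ((hp Z).1 _).1 h0
    change (preadditiveYoneda.map (𝟙 X' - s ≫ f)).app Z ((Limits.kernel.ι p).app Z x) = 0
    rw [← hy]
    change Z.unop ⟶ X at y
    change (y ≫ f) ≫ (𝟙 X' - s ≫ f) = 0
    rw [Category.assoc, Preadditive.comp_sub, hs, Category.comp_id, sub_self, Limits.comp_zero]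
  refine ⟨X', ⟨Abelian.epiDesc p _ hker, p, ?_⟩⟩
  rw [← cancel_epi p, ← Category.assoc, Abelian.comp_epiDesc]
  have : preadditiveYoneda.map (𝟙 X' - s ≫ f) =
      𝟙 _ - preadditiveYoneda.map s ≫ preadditiveYoneda.map f := by
    ext Z x
    change Z.unop ⟶ X' at x
    change x ≫ (𝟙 X' - s ≫ f) = x - (x ≫ s) ≫ f
    rw [Preadditive.comp_sub, Category.comp_id, Category.assoc]
  rw [this, Preadditive.sub_comp, Category.assoc, hfp]
  simp

/-- If the functor presented by `f` is projective in `mod-C`, its presentation splits. The splitting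
comes from an endomorphism `e` of `Y` with `f ≫ e = 0` for which `𝟙 Y - e` factors through `f`, and
the factor is a generalised inverse of `f`. -/
lemma isRegularMor_of_projective (h : ∀ F : FinPresMod C, Projective F) {X Y : C} (f : X ⟶ Y) :
    IsRegularMor f := by
  let y := preadditiveYoneda (C := C)
  let F := Limits.cokernel (y.map f)
  let p : y.obj Y ⟶ F := Limits.cokernel.π (y.map f)
  have hp : ∀ Z : Cᵒᵖ, Function.Exact ((y.map f).app Z) (p.app Z) := fun Z =>
    (ShortComplex.ab_exact_iff_function_exact _).1 ((ShortComplex.exact_cokernel (y.map f)).map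
      ((evaluation Cᵒᵖ AddCommGrpCat.{v}).obj Z))
  have hs : ∀ Z : Cᵒᵖ, Function.Surjective (p.app Z) := fun Z =>
    (AddCommGrpCat.epi_iff_surjective _).1 inferInstance
  have hadd : F.Additive := ⟨fun {U V g g'} => by
    rw [← cancel_epi (p.app U)]
    rw [← p.naturality, Functor.map_add, Preadditive.add_comp, p.naturality, p.naturality,
      Preadditive.comp_add]⟩
  let F' : FinPresMod C := ⟨F, hadd, X, Y, f, p, fun Z => ⟨hp Z, hs Z⟩⟩
  let Y' : FinPresMod C := ⟨y.obj Y, finPresFunctor_of_retract (Retract.refl _)⟩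
  let p' : Y' ⟶ F' := ObjectProperty.homMk p
  have hepi : Epi p' := by
    have : Epi p := inferInstance
    refine ⟨fun a b hab => ?_⟩
    ext1
    exact (cancel_epi p).1 (congrArg (fun t => t.hom) hab)
  obtain ⟨σ', hσ'⟩ := (h F').factors (𝟙 F') p'
  let σ : F ⟶ y.obj Y := σ'.hom
  have hσ : σ ≫ p = 𝟙 F := congrArg (fun t => t.hom) hσ'
  obtain ⟨e, he⟩ := y.map_surjective (p ≫ σ)
  have hfe : f ≫ e = 0 := by
    apply y.map_injective
    rw [y.map_comp, he, ← Category.assoc, Limits.cokernel.condition, Limits.zero_comp]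
    ext Z x
    change Z.unop ⟶ X at x
    exact (Limits.comp_zero (f := x)).symm
  have h1 : p.app (Opposite.op Y) (𝟙 Y - e) = 0 := by
    have h2 : p.app (Opposite.op Y) e = p.app (Opposite.op Y) (𝟙 Y) := by
      have h3 : y.map e ≫ p = p := by rw [he, Category.assoc, hσ, Category.comp_id]
      have h4 := congrArg (fun t : y.obj Y ⟶ F => t.app (Opposite.op Y) (𝟙 Y)) h3
      have h5 : (y.map e).app (Opposite.op Y) (𝟙 Y) = e := Category.id_comp e
      rw [← h5]
      exact h4
    exact (map_sub (p.app (Opposite.op Y)).hom (𝟙 Y) e).trans (sub_eq_zero.2 h2.symm)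
  obtain ⟨s, hs⟩ := (hp _ _).1 h1
  change s ≫ f = 𝟙 Y - e at hs
  exact ⟨s, by rw [hs, Preadditive.comp_sub, hfe, Category.comp_id, sub_zero]⟩

/-- A preadditive category with finite biproducts (given here by their data) all of whose
morphisms are regular has a semisimple abelian category of finitely presented functors. -/
lemma isSemisimpleAbelian_finPresMod [Nonempty C]
    (h : ∀ ⦃X Y : C⦄ (f : X ⟶ Y), IsRegularMor f)
    (hprod : ∀ X Y : C, ∃ (Z : C) (i₁ : X ⟶ Z) (i₂ : Y ⟶ Z) (p₁ : Z ⟶ X) (p₂ : Z ⟶ Y),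
      i₁ ≫ p₁ = 𝟙 X ∧ i₂ ≫ p₂ = 𝟙 Y ∧ i₁ ≫ p₂ = 0 ∧ i₂ ≫ p₁ = 0) :
    IsSemisimpleAbelian (FinPresMod C) := by
  have hreg : ∀ ⦃F G : Cᵒᵖ ⥤ AddCommGrpCat.{v}⦄ (φ : F ⟶ G), finPresFunctor C F →
      finPresFunctor C G → IsRegularMor φ := fun F G φ hF hG => by
    obtain ⟨X, ⟨a⟩⟩ := exists_retract_of_finPresFunctor h hF
    obtain ⟨Y, ⟨b⟩⟩ := exists_retract_of_finPresFunctor h hG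
    exact isRegularMor_of_retract preadditiveYoneda h a b φ
  have hret : (finPresFunctor C).IsStableUnderRetracts := ⟨fun {F G} a hG => by
    obtain ⟨X, ⟨b⟩⟩ := exists_retract_of_finPresFunctor h hG
    exact finPresFunctor_of_retract (a.trans b)⟩
  have : (finPresFunctor C).Nonempty := ObjectProperty.nonempty_of_prop
    (finPresFunctor_of_retract (Retract.refl (preadditiveYoneda.obj (Classical.arbitrary C))))
  have hker := isClosedUnderKernels_of_isRegularMor _ hreg
  have hcok := isClosedUnderCokernels_of_isRegularMor _ hreg
  have hbin : (finPresFunctor C).IsClosedUnderBinaryProducts := .mk' <| by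
    rintro _ ⟨D, hD⟩
    obtain ⟨X, ⟨a⟩⟩ := exists_retract_of_finPresFunctor h (hD ⟨.left⟩)
    obtain ⟨Y, ⟨b⟩⟩ := exists_retract_of_finPresFunctor h (hD ⟨.right⟩)
    obtain ⟨Z, i₁, i₂, p₁, p₂, h11, h22, h12, h21⟩ := hprod X Y
    let y := preadditiveYoneda (C := C)
    have hadd : y.Additive := ⟨fun {U V f g} => by
      ext W x
      exact Preadditive.comp_add _ _ _ _ _ _⟩
    let π₁ : Limits.limit D ⟶ D.obj ⟨.left⟩ := Limits.limit.π D ⟨.left⟩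
    let π₂ : Limits.limit D ⟶ D.obj ⟨.right⟩ := Limits.limit.π D ⟨.right⟩
    let c : Limits.Cone D := ⟨y.obj Z, Discrete.natTrans fun j => match j with
      | ⟨.left⟩ => y.map p₁ ≫ a.r
      | ⟨.right⟩ => y.map p₂ ≫ b.r⟩
    have hc₁ : Limits.limit.lift D c ≫ π₁ = y.map p₁ ≫ a.r := Limits.limit.lift_π c ⟨.left⟩
    have hc₂ : Limits.limit.lift D c ≫ π₂ = y.map p₂ ≫ b.r := Limits.limit.lift_π c ⟨.right⟩
    have e11 : y.map i₁ ≫ y.map p₁ = 𝟙 _ := by rw [← y.map_comp, h11, y.map_id]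
    have e22 : y.map i₂ ≫ y.map p₂ = 𝟙 _ := by rw [← y.map_comp, h22, y.map_id]
    have e12 : y.map i₁ ≫ y.map p₂ = 0 := by rw [← y.map_comp, h12, y.map_zero]
    have e21 : y.map i₂ ≫ y.map p₁ = 0 := by rw [← y.map_comp, h21, y.map_zero]
    -- The product of `D` is a retract of the functor represented by the biproduct `Z`.
    refine finPresFunctor_of_retract (X := Z)
      ⟨π₁ ≫ a.i ≫ y.map i₁ + π₂ ≫ b.i ≫ y.map i₂, Limits.limit.lift D c, ?_⟩
    refine Limits.limit.hom_ext ?_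
    rintro ⟨_ | _⟩
    · change _ ≫ π₁ = 𝟙 _ ≫ π₁
      rw [Category.assoc, hc₁, Preadditive.add_comp]
      simp [reassoc_of% e11, reassoc_of% e21]
    · change _ ≫ π₂ = 𝟙 _ ≫ π₂
      rw [Category.assoc, hc₂, Preadditive.add_comp]
      simp [reassoc_of% e12, reassoc_of% e22]
  have hfin : (finPresFunctor C).IsClosedUnderFiniteProducts := .mk'
  refine ⟨⟨inferInstance⟩, projective_of_isRegularMor fun F G φ => ?_⟩
  obtain ⟨s, hs⟩ := hreg φ.hom F.property G.property
  exact ⟨ObjectProperty.homMk s, by ext1; exact hs⟩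

end FinPres

/-! ### The stable category of Gorenstein projective modules -/

section Stable

variable {A : Type u} [Ring A]

lemma stableRel_iff {X Y : (gprj A).FullSubcategory} (f g : X ⟶ Y) :
    stableRel A f g ↔ StablyZero (f.hom.hom - g.hom.hom) := by
  constructor
  · rintro ⟨P, a, b, hP, hP', h⟩
    exact ⟨P, a.hom, b.hom, hP, hP', congrArg ModuleCat.Hom.hom h⟩
  · rintro ⟨P, a, b, hP, hP', h⟩
    exact ⟨P, ModuleCat.ofHom a, ModuleCat.ofHom b, hP, hP',
      ModuleCat.hom_ext h⟩

lemma isRegularMor_stable_iff {X Y : (gprj A).FullSubcategory} (f : X ⟶ Y) :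
    IsRegularMor ((Quotient.functor (stableRel A)).map f) ↔ StablyRegular f.hom.hom := by
  constructor
  · rintro ⟨s, hs⟩
    obtain ⟨s, rfl⟩ := (Quotient.functor (stableRel A)).map_surjective s
    rw [← Functor.map_comp, ← Functor.map_comp, eq_comm, Quotient.functor_map_eq_iff,
      stableRel_iff] at hs
    exact ⟨s.hom.hom, hs⟩
  · rintro ⟨s, hs⟩
    refine ⟨(Quotient.functor (stableRel A)).map (ObjectProperty.homMk (ModuleCat.ofHom s)), ?_⟩
    rw [← Functor.map_comp, ← Functor.map_comp, eq_comm, Quotient.functor_map_eq_iff,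
      stableRel_iff]
    exact hs

/-- If the Gorenstein projective modules are the torsionless ones, semisimplicity of `mod` of
their stable category is regularity, modulo projectives, of all linear maps between them. -/
lemma TorsionlessIffExtVanish.isSemisimpleAbelian_iff [IsNoetherianRing A] [IsNoetherian Aᵐᵒᵖ A]
    (h : TorsionlessIffExtVanish A) : IsSemisimpleAbelian (FinPresMod (StableGprj A)) ↔
      ∀ (X Y : Type u) [AddCommGroup X] [Module A X] [AddCommGroup Y] [Module A Y]
        [Module.Finite A X] [Module.Finite A Y] (f : X →ₗ[A] Y), Torsionless A X →
        Torsionless A Y → StablyRegular f := by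
  constructor
  · rintro ⟨-, hproj⟩ X Y _ _ _ _ _ _ f hX hY
    let X' : (gprj A).FullSubcategory := ⟨ModuleCat.of A X, (h.gprj_iff _).2 ⟨‹_›, hX⟩⟩
    let Y' : (gprj A).FullSubcategory := ⟨ModuleCat.of A Y, (h.gprj_iff _).2 ⟨‹_›, hY⟩⟩
    let f' : X' ⟶ Y' := ObjectProperty.homMk (ModuleCat.ofHom f)
    exact (isRegularMor_stable_iff f').1 (isRegularMor_of_projective hproj _)
  · intro hreg
    have h0 : gprj A (ModuleCat.of A PUnit.{u + 1}) :=
      (h.gprj_iff _).2 ⟨inferInstanceAs (Module.Finite A PUnit.{u + 1}),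
        torsionless_projective (A := A) (P := PUnit.{u + 1})⟩
    let Q := Quotient.functor (stableRel A)
    have : Q.Additive := Quotient.functor_additive (stableRel A) stableRel_add
    have : Nonempty (StableGprj A) := ⟨Q.obj ⟨_, h0⟩⟩
    refine isSemisimpleAbelian_finPresMod ?_ ?_
    · rintro ⟨X⟩ ⟨Y⟩ f
      obtain ⟨f, rfl⟩ := Q.map_surjective (X := X) (Y := Y) f
      have hX := (h.gprj_iff _).1 X.property
      have hY := (h.gprj_iff _).1 Y.property
      have := hX.1
      have := hY.1
      exact (isRegularMor_stable_iff f).2 (hreg _ _ f.hom.hom hX.2 hY.2)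
    · rintro ⟨X⟩ ⟨Y⟩
      have hX := (h.gprj_iff _).1 X.property
      have hY := (h.gprj_iff _).1 Y.property
      have := hX.1
      have := hY.1
      let Z : (gprj A).FullSubcategory := ⟨ModuleCat.of A (X.obj × Y.obj),
        (h.gprj_iff _).2 ⟨inferInstanceAs (Module.Finite A (X.obj × Y.obj)), hX.2.prod hY.2⟩⟩
      let i₁ : X ⟶ Z := ObjectProperty.homMk (ModuleCat.ofHom (LinearMap.inl A X.obj Y.obj))
      let i₂ : Y ⟶ Z := ObjectProperty.homMk (ModuleCat.ofHom (LinearMap.inr A X.obj Y.obj))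
      let p₁ : Z ⟶ X := ObjectProperty.homMk (ModuleCat.ofHom (LinearMap.fst A X.obj Y.obj))
      let p₂ : Z ⟶ Y := ObjectProperty.homMk (ModuleCat.ofHom (LinearMap.snd A X.obj Y.obj))
      refine ⟨Q.obj Z, Q.map i₁, Q.map i₂, Q.map p₁, Q.map p₂, ?_, ?_, ?_, ?_⟩
      · exact (Q.map_comp i₁ p₁).symm.trans (Q.map_id X)
      · exact (Q.map_comp i₂ p₂).symm.trans (Q.map_id Y)
      · exact (Q.map_comp i₁ p₂).symm.trans (Q.map_zero X Y)
      · exact (Q.map_comp i₂ p₁).symm.trans (Q.map_zero Y X)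

/-- The equivalence for an artinian ring `A`, with `rad A ⊕ A` in the place of the module
`rad Λ ⊕ Λ`. -/
lemma torsionlessIffExtVanish_and_isSemisimpleAbelian_iff [IsArtinianRing A]
    [IsNoetherian Aᵐᵒᵖ A] :
    (TorsionlessIffExtVanish A ∧ IsSemisimpleAbelian (FinPresMod (StableGprj A))) ↔
      ∀ G : ModuleCat.{u} A, gprj A G ↔ InAdd A (Module.jacobson A A × A) G := by
  have hM : Torsionless A (Module.jacobson A A × A) :=
    ((torsionless_projective (P := A)).of_injective _ (Submodule.subtype_injective _)).prod
      torsionless_projective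
  constructor
  · rintro ⟨h, hss⟩ G
    refine ⟨inAdd_of_gprj (h.isSemisimpleAbelian_iff.1 hss), fun hG => ?_⟩
    exact (h.gprj_iff G).2 ⟨hG.finite, hG.torsionless hM⟩
  · intro h
    have hA : InAdd A (Module.jacobson A A × A) A :=
      .of_retract (LinearMap.inr A _ _) (LinearMap.snd A _ _) fun _ => rfl
    have hrad : InAdd A (Module.jacobson A A × A) (Module.jacobson A A) :=
      .of_retract (LinearMap.inl A _ _) (LinearMap.fst A _ _) fun _ => rfl
    have hGor : TorsionlessIffExtVanish A := torsionlessIffExtVanish_of_jacobson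
      (fun P _ _ => ((h P).2 (hA.trans (inAdd_projective P))).cosyzygyEmbeddable)
      (fun P _ _ => gprj.cosyzygyEmbeddable (G := ModuleCat.of A (Module.jacobson A P))
        ((h _).2 (hrad.trans (inAdd_projective (A := A) P).jacobson)))
    have hadd : ∀ (X : Type u) [AddCommGroup X] [Module A X] [Module.Finite A X],
        Torsionless A X → InAdd A (Module.jacobson A A × A) X := fun X _ _ hfin hX =>
      (h (ModuleCat.of A X)).1 ((hGor.gprj_iff _).2 ⟨hfin, hX⟩)
    exact ⟨hGor, hGor.isSemisimpleAbelian_iff.2 fun X Y _ _ _ _ _ _ f hX hY =>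
      stablyRegular_of_inAdd hGor hadd hX hY f⟩

end Stable

end GProj

theorem mainTheorem3 (R : Type*) [CommRing R] [IsArtinianRing R]
    (Λ : Type*) [Ring Λ] [Algebra R Λ] [Module.Finite R Λ] :
    (GProj.IsIwanagaGorenstein Λ 1 ∧ GProj.IsOmegaGAlgebra Λ) ↔
      GProj.gprj Λᵐᵒᵖ =
        GProj.addClosure (ModuleCat.of Λᵐᵒᵖ (Module.jacobson Λᵐᵒᵖ Λ × Λ)) := by
  have : Module.Finite R Λᵐᵒᵖ := .equiv (MulOpposite.opLinearEquiv R (M := Λ))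
  have : IsNoetherianRing Λ := isNoetherian_of_tower R inferInstance
  have : IsNoetherianRing Λᵐᵒᵖ := isNoetherian_of_tower R inferInstance
  have : IsArtinianRing Λᵐᵒᵖ := isArtinian_of_tower R inferInstance
  have : IsNoetherian Λᵐᵒᵖᵐᵒᵖ Λᵐᵒᵖ := isNoetherian_of_tower R inferInstance
  -- The two forms of the regular right `Λ`-module.
  let e : Λ ≃ₗ[Λᵐᵒᵖ] Λᵐᵒᵖ := { MulOpposite.opAddEquiv with map_smul' := fun _ _ => rfl }
  rw [GProj.isIwanagaGorenstein_one_iff, GProj.IsOmegaGAlgebra,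
    GProj.torsionlessIffExtVanish_and_isSemisimpleAbelian_iff]
  have key : ∀ G : ModuleCat Λᵐᵒᵖ,
      GProj.addClosure (ModuleCat.of Λᵐᵒᵖ (Module.jacobson Λᵐᵒᵖ Λ × Λ)) G ↔
        GProj.InAdd Λᵐᵒᵖ (Module.jacobson Λᵐᵒᵖ Λᵐᵒᵖ × Λᵐᵒᵖ) G := fun G =>
    (GProj.addClosure_iff _ G).trans
      ⟨(GProj.InAdd.of_equiv e.symm).jacobson_prod_self.trans,
        (GProj.InAdd.of_equiv e).jacobson_prod_self.trans⟩
  constructor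
  · intro h
    ext G
    exact (h G).trans (key G).symm
  · intro h G
    rw [h]
    exact key G
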